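/- All graphs are finite, simple and non-empty. A graph is well-covered if each of its maximal independent sets is a maximum independent set. An $(r,\ell)$-partition of a graph is a partition of its vertex set into $r$ independent sets and $\ell$ cliques, some of which may be empty; a graph with such a partition is an $(r,\ell)$-graph. A parameterized problem is a set $L\subseteq\Sigma^*\times\mathbb N$ for a finite alphabet $\Sigma$; an instance $I=(x,k)$ has parameter $k$. The problem $k$-Well-Covered Graph has as input a graph $G$ and a parameter $k$, and asks whether every maximal independent set of $G$ has size exactly $k$. The problem wc-$(0,\ell)$g parameterized by $\ell$ has as input $\ell$ (the parameter) and a graph together with a $(0,\ell)$-partition of it, and asks whether the graph is well-covered. An fpt-reduction from $L$ to $L'$ is a map $R$ that sends each $I=(x,k)$ to some $I'=(x',k')$ with $I\in L\iff I'\in L'$ and $k'\le g(k)$, and that is computed by a Turing machine in time at most $f(k)\,(|x|+k+1)^c$, where $f,g$ are computable functions and $c$ is a constant. **Lemma.** The problem $k$-Well-Covered Graph fpt-reduces to the problem wc-$(0,\ell)$g parameterized by $\ell$. The reduction can be chosen so that for every graph $G$ and every $k\ge 1$ it maps $(G,k)$ to a graph given with a $(0,k+1)$-partition, with parameter $\ell=k+1$.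 Moreover, let $G=(V,E)$ be a graph that has a maximal independent set of size $k$, and let $G'$ be the graph on $\{1,\dots,k+1\}\times V$ in which distinct vertices $(i,a)$ and $(j,b)$ are adjacent if and only if $i=j$ or $a=b$ or $ab\in E$. Then the $k+1$ sets $\{i\}\times V$ are cliques that partition the vertex set of $G'$, so $G'$ is a $(0,k+1)$-graph, and $G'$ is well-covered if and only if every maximal independent set of $G$ has size exactly $k$. -/

import Mathlib

/-! ### Well-covered graphs and `(r, ℓ)`-partitions -/

/-- A finite graph is well-covered if every maximal independent set is maximum. -/
def IsWellCovered {V : Type*} [Finite V] (G : SimpleGraph V) : Prop :=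
  ∀ S : Finset V, Maximal G.IsIndepSet (S : Set V) → G.IsMaximumIndepSet S

/-- Every maximal independent set has size exactly `k`. -/
def IsKWellCovered {V : Type*} (G : SimpleGraph V) (k : ℕ) : Prop :=
  ∀ S : Finset V, Maximal G.IsIndepSet (S : Set V) → S.card = k

/-- `p` describes a partition of the vertices into `r` independent sets (the fibres over
`Sum.inl i`) and `ℓ` cliques (the fibres over `Sum.inr j`); parts may be empty. -/
def IsRLPartition {V : Type*} (G : SimpleGraph V) (r ℓ : ℕ) (p : V → Fin r ⊕ Fin ℓ) : Prop :=
  (∀ i : Fin r, G.IsIndepSet {v | p v = Sum.inl i}) ∧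
    ∀ j : Fin ℓ, G.IsClique {v | p v = Sum.inr j}

/-- `ℓ` copies of the vertex set of `G`. Each copy is a clique, all copies of the same vertex are
pairwise adjacent, and if `a`, `b` are adjacent in `G` then every copy of `a` is adjacent to every
copy of `b`. -/
def cliqueCopies {V : Type*} (G : SimpleGraph V) (ℓ : ℕ) : SimpleGraph (Fin ℓ × V) where
  Adj p q := p ≠ q ∧ (p.1 = q.1 ∨ p.2 = q.2 ∨ G.Adj p.2 q.2)
  symm := ⟨fun _ _ h => ⟨h.1.symm, h.2.imp Eq.symm (Or.imp Eq.symm SimpleGraph.Adj.symm)⟩⟩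
  loopless := ⟨fun _ h => h.1 rfl⟩

/-! ### Parameterized problems and fpt-reductions -/

/-- A parameterized problem over the alphabet `Γ`. -/
abbrev ParamProblem (Γ : Type) : Type := Set (List Γ × ℕ)

/-- The input word of an instance `(x, k)`: the parameter in unary (`k` symbols `none`) followed
by the word `x`. Its length is `|x| + k`. -/
def encodeInstance {Γ : Type} (I : List Γ × ℕ) : List (Option Γ) :=
  List.replicate I.2 none ++ I.1.map some

/-- `R` is computed by a multi-stack Turing machine which on every instance `(x, k)` halts after at
most `f k * (|x| + k + 1) ^ c` steps, for a computable function `f` and a constant `c`. -/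
def IsFptComputable {Γ Γ' : Type} (R : List Γ × ℕ → List Γ' × ℕ) : Prop :=
  ∃ (M : Turing.TM2ComputableAux (Option Γ) (Option Γ')) (f : ℕ → ℕ) (c : ℕ), Computable f ∧
    ∀ I : List Γ × ℕ,
      Nonempty (Turing.TM2OutputsInTime M.tm
        ((encodeInstance I).map M.inputAlphabet.symm)
        (some ((encodeInstance (R I)).map M.outputAlphabet.symm))
        (f I.2 * (I.1.length + I.2 + 1) ^ c))

/-- `R` is an fpt-reduction from `A` to `B`. -/
structure IsFptReduction {Γ Γ' : Type} [Finite Γ] [Finite Γ'] (A : ParamProblem Γ)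
    (B : ParamProblem Γ') (R : List Γ × ℕ → List Γ' × ℕ) : Prop where
  /-- The instance computed from `I` is equivalent to `I`. -/
  correct : ∀ I, I ∈ A ↔ R I ∈ B
  /-- `R` is computed in time `f(k) |I|^c`. -/
  computable : IsFptComputable R
  /-- The new parameter is bounded by a computable function of the old one. -/
  param_bound : ∃ g : ℕ → ℕ, Computable g ∧ ∀ I, (R I).2 ≤ g I.2

/-! ### Graphs as words

The word of a graph on `{0, …, n - 1}` lists its vertices in increasing order. Each vertex is
written as the symbol `vertex`, followed, if a partition is given, by the part of the vertex in
unary, followed by the adjacency bits with the smaller vertices (a lower triangular adjacency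
matrix). -/

/-- The alphabet for graphs. -/
inductive GraphSymbol : Type
  | vertex
  | bit (b : Bool)

/-- The alphabet for graphs with an `(r, ℓ)`-partition. -/
inductive PartSymbol : Type
  | indep
  | clique
  | sym (s : GraphSymbol)

instance : Finite GraphSymbol :=
  Finite.of_surjective
    (fun o : Option Bool => o.elim GraphSymbol.vertex GraphSymbol.bit) fun s => by
      cases s with
      | vertex => exact ⟨none, rfl⟩
      | bit b => exact ⟨some b, rfl⟩

instance : Finite PartSymbol :=
  Finite.of_surjective
    (fun o : Bool ⊕ GraphSymbol =>
      o.elim (fun b => if b then PartSymbol.indep else PartSymbol.clique) PartSymbol.sym) fun s => by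
      cases s with
      | indep => exact ⟨Sum.inl true, rfl⟩
      | clique => exact ⟨Sum.inl false, rfl⟩
      | sym s => exact ⟨Sum.inr s, rfl⟩

open Classical in
/-- The adjacency bits of the vertex `i` with the vertices `0, …, i - 1`. -/
noncomputable def encodeRow {n : ℕ} (G : SimpleGraph (Fin n)) (i : Fin n) : List GraphSymbol :=
  List.ofFn fun j : Fin i.val => GraphSymbol.bit (decide (G.Adj i ⟨j, j.isLt.trans i.isLt⟩))

/-- The word of a graph. -/
noncomputable def encodeGraph {n : ℕ} (G : SimpleGraph (Fin n)) : List GraphSymbol :=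
  (List.finRange n).flatMap fun i => GraphSymbol.vertex :: encodeRow G i

/-- The unary code of a part: `i + 1` symbols `indep` for the `i`-th independent set, and `j + 1`
symbols `clique` for the `j`-th clique. -/
def encodePart {r ℓ : ℕ} : Fin r ⊕ Fin ℓ → List PartSymbol
  | Sum.inl i => List.replicate (i.val + 1) PartSymbol.indep
  | Sum.inr j => List.replicate (j.val + 1) PartSymbol.clique

/-- The word of a graph with a partition. -/
noncomputable def encodeRLGraph {n r ℓ : ℕ} (G : SimpleGraph (Fin n))
    (p : Fin n → Fin r ⊕ Fin ℓ) : List PartSymbol :=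
  (List.finRange n).flatMap fun i =>
    PartSymbol.sym GraphSymbol.vertex :: (encodePart (p i) ++ (encodeRow G i).map PartSymbol.sym)

/-! ### The two problems -/

/-- The problem `k`-Well-Covered Graph, parameterized by `k`: given a (non-empty) graph `G` and `k`,
does every maximal independent set of `G` have size exactly `k`? -/
def kWellCoveredGraph : ParamProblem GraphSymbol :=
  {I | ∃ (n : ℕ) (G : SimpleGraph (Fin n)), 0 < n ∧ I.1 = encodeGraph G ∧ IsKWellCovered G I.2}

/-- The problem wc-`(r, ℓ)`g for fixed `r`, parameterized by `ℓ`: given a (non-empty) graph `G`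
together with an `(r, ℓ)`-partition, is `G` well-covered? -/
def wcRLGraph (r : ℕ) : ParamProblem PartSymbol :=
  {I | ∃ (n : ℕ) (G : SimpleGraph (Fin n)) (p : Fin n → Fin r ⊕ Fin I.2), 0 < n ∧
    IsRLPartition G r I.2 p ∧ I.1 = encodeRLGraph G p ∧ IsWellCovered G}

/-! An independent set of `cliqueCopies G (k + 1)` uses each clique at most once and each vertex of
`G` at most once, and it projects to an independent set of `G`. So it amounts to an independent set
of `G` with at most `k + 1` elements, placed injectively in the cliques. If it has at most `k`
elements, some clique is free, and maximality passes to the projection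
(`maximal_image_snd_of_card_lt`); conversely, maximal sets with at most `k + 1` elements lift
(`exists_maximal_cliqueCopies`). The extra clique detects larger sets: `k + 1` independent vertices
of `G` lift to an independent set that is too big. Hence "all maximal independent sets have size
`k`" holds for `G` and for the copies simultaneously (`isKWellCovered_cliqueCopies_iff`). If one
maximal independent set is known to have size `k`, this property is the same as being well-covered
(`isWellCovered_iff_of_exists`).

An arbitrary input need not have such a set, so the reduction plants one: it joins the copies with
`k` new independent vertices. The join creates no other new maximal independent set, and the new
vertices fit into `k` different cliques, so `k + 1` cliques still suffice. The cases `k = 0` and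
empty graph go to a fixed no-instance.

Words that encode no graph are not filtered out. Rows are expanded blindly, and
`eq_range_of_flatMap_eq_range` shows that the output has rows of lengths `0, 1, 2, …` only if the
input has. For the time bound, the reduction is written as a structured stack program, compiled to a
machine by `code`, and its running time is computed from the big-step semantics `Runs`. -/

/-! ### A small imperative language over stacks, compiled to multi-stack Turing machines -/

/-- Programs acting on a family of stacks with alphabets `Γ`. -/
inductive StackProg {K : Type} (Γ : K → Type) : Type
  /-- Do nothing. -/
  | skip
  /-- Push a fixed symbol. -/
  | push (k : K) (a : Γ k)
  /-- Run two programs one after the other. -/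
  | seq (p q : StackProg Γ)
  /-- Run `p` if the stack `k` is empty, and `q` otherwise. -/
  | ite (k : K) (p q : StackProg Γ)
  /-- While the stack `k` is non-empty, pop a symbol `a` and run `body a`. -/
  | loop (k : K) (body : Γ k → StackProg Γ)

namespace StackProg

variable {K : Type} {Γ : K → Type}

/-- The labels used by the code of a program. -/
def Label : StackProg Γ → Type
  | skip => Unit
  | push _ _ => Unit
  | seq p q => Label p ⊕ Label q
  | ite _ p q => Unit ⊕ (Label p ⊕ Label q)
  | loop k body => Unit ⊕ (Σ a : Γ k, Label (body a))

/-- The label at which the code of a program is entered. -/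
def entry : (p : StackProg Γ) → Label p
  | skip => ()
  | push _ _ => ()
  | seq p _ => Sum.inl (entry p)
  | ite _ _ _ => Sum.inl ()
  | loop _ _ => Sum.inl ()

/-- A loop contributes one block of labels per symbol, so finiteness of the label set rests on
finiteness of the alphabets. -/
theorem finite_label [∀ k, Finite (Γ k)] : (p : StackProg Γ) → Finite (Label p)
  | skip => inferInstanceAs (Finite Unit)
  | push _ _ => inferInstanceAs (Finite Unit)
  | seq p q =>
    have := finite_label p
    have := finite_label q
    inferInstanceAs (Finite (Label p ⊕ Label q))
  | ite _ p q =>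
    have := finite_label p
    have := finite_label q
    inferInstanceAs (Finite (Unit ⊕ (Label p ⊕ Label q)))
  | loop k body =>
    have := fun a => finite_label (body a)
    inferInstanceAs (Finite (Unit ⊕ (Σ a : Γ k, Label (body a))))

variable [DecidableEq K]

/-- The code of a program. The machine state remembers the last symbol read from each stack;
`e` embeds the labels of the program, and control is passed to `exit` at the end. -/
def code {Λ : Type} : (p : StackProg Γ) → (Label p → Λ) → Λ → Label p →
    Turing.TM2.Stmt Γ Λ (∀ k, Option (Γ k))
  | skip, _, exit, _ => .goto fun _ => exit
  | push k a, _, exit, _ => .push k (fun _ => a) (.goto fun _ => exit)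
  | seq p q, e, exit, l =>
    match l with
    | Sum.inl l => code p (fun l => e (Sum.inl l)) (e (Sum.inr (entry q))) l
    | Sum.inr l => code q (fun l => e (Sum.inr l)) exit l
  | ite k p q, e, exit, l =>
    match l with
    -- The symbol read is kept in the register of `k`, because a `goto` can depend only on the
    -- machine state.
    | Sum.inl _ => .peek k (fun v a => Function.update v k a) (.goto fun v =>
        if (v k).isSome then e (Sum.inr (Sum.inr (entry q))) else e (Sum.inr (Sum.inl (entry p))))
    | Sum.inr (Sum.inl l) => code p (fun l => e (Sum.inr (Sum.inl l))) exit l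
    | Sum.inr (Sum.inr l) => code q (fun l => e (Sum.inr (Sum.inr l))) exit l
  | loop k body, e, exit, l =>
    match l with
    | Sum.inl _ => .pop k (fun v a => Function.update v k a) (.goto fun v =>
        (v k).elim exit fun a => e (Sum.inr ⟨a, entry (body a)⟩))
    | Sum.inr ⟨a, l⟩ => code (body a) (fun l => e (Sum.inr ⟨a, l⟩)) (e (Sum.inl ())) l

/-- `Runs p S n S'`: started with the stacks `S`, the program `p` stops after `n` steps with the
stacks `S'`. -/
inductive Runs : StackProg Γ → (∀ k, List (Γ k)) → ℕ → (∀ k, List (Γ k)) → Prop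
  | skip (S) : Runs skip S 1 S
  | push (k a S) : Runs (push k a) S 1 (Function.update S k (a :: S k))
  | seq {p q S S' S'' m n} : Runs p S m S' → Runs q S' n S'' → Runs (seq p q) S (m + n) S''
  | ite_nil {k p q S S' n} : S k = [] → Runs p S n S' → Runs (ite k p q) S (1 + n) S'
  | ite_cons {k p q S S' n} : S k ≠ [] → Runs q S n S' → Runs (ite k p q) S (1 + n) S'
  | loop_nil {k body S} : S k = [] → Runs (loop k body) S 1 S
  | loop_cons {k body S S' S'' a l m n} : S k = a :: l →
      Runs (body a) (Function.update S k l) m S' → Runs (loop k body) S' n S'' →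
      Runs (loop k body) S (1 + m + n) S''

/-- A configuration leads to another one in exactly `n` steps. -/
def Reaches {Λ σ : Type} (M : Λ → Turing.TM2.Stmt Γ Λ σ) (n : ℕ)
    (c c' : Turing.TM2.Cfg Γ Λ σ) : Prop :=
  (flip bind (Turing.TM2.step M))^[n] (some c) = some c'

theorem Reaches.trans {Λ σ : Type} {M : Λ → Turing.TM2.Stmt Γ Λ σ} {m n : ℕ}
    {c c' c'' : Turing.TM2.Cfg Γ Λ σ} (h : Reaches M m c c') (h' : Reaches M n c' c'') :
    Reaches M (m + n) c c'' := by
  unfold Reaches at *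
  rw [Nat.add_comm, Function.iterate_add_apply, h, h']

theorem Reaches.single {Λ σ : Type} {M : Λ → Turing.TM2.Stmt Γ Λ σ}
    {c c' : Turing.TM2.Cfg Γ Λ σ} (h : Turing.TM2.step M c = some c') : Reaches M 1 c c' := h

/-- The code of a program follows its big-step semantics. -/
theorem Runs.reaches {Λ : Type} {M : Λ → Turing.TM2.Stmt Γ Λ (∀ k, Option (Γ k))}
    {p : StackProg Γ} {S S' : ∀ k, List (Γ k)} {n : ℕ} (h : Runs p S n S')
    (e : Label p → Λ) (exit : Λ) (hM : ∀ l, M (e l) = code p e exit l) (v : ∀ k, Option (Γ k)) :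
    ∃ v', Reaches M n ⟨some (e (entry p)), v, S⟩ ⟨some exit, v', S'⟩ := by
  induction h generalizing exit v with
  | skip S =>
    refine ⟨v, .single ?_⟩
    simp [Turing.TM2.step, hM, code]
  | push k a S =>
    refine ⟨v, .single ?_⟩
    simp [Turing.TM2.step, hM, code]
  | @seq p q S S' S'' m n _ _ ihp ihq =>
    obtain ⟨v', h'⟩ := ihp (fun l => e (Sum.inl l)) (e (Sum.inr (entry q)))
      (fun l => hM (Sum.inl l)) v
    obtain ⟨v'', h''⟩ := ihq (fun l => e (Sum.inr l)) exit (fun l => hM (Sum.inr l)) v'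
    exact ⟨v'', h'.trans h''⟩
  | @ite_nil k p q S S' n hS _ ih =>
    obtain ⟨v', h'⟩ := ih (fun l => e (Sum.inr (Sum.inl l))) exit
      (fun l => hM (Sum.inr (Sum.inl l))) (Function.update v k none)
    refine ⟨v', Reaches.trans (.single ?_) h'⟩
    change some (Turing.TM2.stepAux (M (e (entry (ite k p q)))) v S) = _
    rw [hM]
    simp [code, hS, entry]
  | @ite_cons k p q S S' n hS _ ih =>
    obtain ⟨a, l, hS⟩ := List.exists_cons_of_ne_nil hS
    obtain ⟨v', h'⟩ := ih (fun l => e (Sum.inr (Sum.inr l))) exit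
      (fun l => hM (Sum.inr (Sum.inr l))) (Function.update v k (some a))
    refine ⟨v', Reaches.trans (.single ?_) h'⟩
    change some (Turing.TM2.stepAux (M (e (entry (ite k p q)))) v S) = _
    rw [hM]
    simp [code, hS, entry]
  | @loop_nil k body S hS =>
    refine ⟨Function.update v k none, .single ?_⟩
    change some (Turing.TM2.stepAux (M (e (entry (loop k body)))) v S) = _
    rw [hM]
    simp [code, hS, entry]
  | @loop_cons k body S S' S'' a l m n hS _ _ ihb ihl =>
    obtain ⟨v', h'⟩ := ihb (fun l => e (Sum.inr ⟨a, l⟩)) (e (Sum.inl ()))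
      (fun l => hM (Sum.inr ⟨a, l⟩)) (Function.update v k (some a))
    obtain ⟨v'', h''⟩ := ihl e exit hM v'
    refine ⟨v'', (Reaches.trans (.single ?_) h').trans h''⟩
    change some (Turing.TM2.stepAux (M (e (entry (loop k body)))) v S) = _
    rw [hM]
    simp [code, hS, entry]

/-- Like `Runs`, with an upper bound for the number of steps. -/
def RunsLE (p : StackProg Γ) (S : ∀ k, List (Γ k)) (n : ℕ) (S' : ∀ k, List (Γ k)) : Prop :=
  ∃ m ≤ n, Runs p S m S'

/-- The machine that runs a program and halts. -/
noncomputable def machine [Fintype K] [∀ k, Finite (Γ k)] (k₀ k₁ : K) (p : StackProg Γ) :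
    Turing.FinTM2 where
  k₀ := k₀
  k₁ := k₁
  Γ := Γ
  Λ := Option (Label p)
  main := some (entry p)
  ΛFin := have := finite_label p; Fintype.ofFinite _
  σ := ∀ k, Option (Γ k)
  initialState := fun _ => none
  σFin := Fintype.ofFinite _
  Γk₀Fin := Fintype.ofFinite _
  m
    | some l => code p some none l
    -- The halting configuration must carry the initial state, so one last step resets the
    -- registers.
    | none => .load (fun _ _ => none) .halt

/-- `initList` and `haltList` fill a single stack through this dependent `if`. -/
theorem dite_eq_update (k₀ : K) (x : List (Γ k₀)) :
    (fun k => if h : k = k₀ then (by rw [h]; exact x) else ([] : List (Γ k))) =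
      Function.update (fun _ => []) k₀ x := by
  funext k
  by_cases hk : k = k₀
  · subst hk; simp
  · simp [hk]

/-- The additional step is the one that resets the registers and halts. Every stack other than `k₁`
has to be empty at the end, so programs must clean up after themselves. -/
theorem RunsLE.outputsInTime [Fintype K] [∀ k, Finite (Γ k)] {k₀ k₁ : K} {p : StackProg Γ}
    {n : ℕ} {x : List (Γ k₀)} {y : List (Γ k₁)}
    (h : RunsLE p (Function.update (fun _ => []) k₀ x) n (Function.update (fun _ => []) k₁ y)) :
    Nonempty (Turing.TM2OutputsInTime (machine k₀ k₁ p) x (some y) (n + 1)) := by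
  obtain ⟨m, hm, h⟩ := h
  obtain ⟨v, hv⟩ := h.reaches (M := (machine k₀ k₁ p).m) some none (fun _ => rfl) fun _ => none
  refine ⟨⟨⟨m + 1, ?_⟩, Nat.succ_le_succ hm⟩⟩
  have h₀ : Turing.initList (machine k₀ k₁ p) x =
      ⟨some (some (entry p)), fun _ => none, Function.update (fun _ => []) k₀ x⟩ :=
    congrArg _ (dite_eq_update k₀ x)
  have h₁ : Turing.haltList (machine k₀ k₁ p) y =
      ⟨none, fun _ => none, Function.update (fun _ => []) k₁ y⟩ :=
    congrArg _ (dite_eq_update k₁ y)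
  have := hv.trans (.single (c' := ⟨none, fun _ => none, Function.update (fun _ => []) k₁ y⟩) rfl)
  rw [h₀]
  exact Eq.trans this (congrArg some h₁.symm)

end StackProg

/-! ### Rules for running times up to an upper bound -/

namespace StackProg

section Rules

variable {K : Type} {Γ : K → Type} [DecidableEq K] {S S' S'' : ∀ k, List (Γ k)}
  {p q : StackProg Γ} {m n : ℕ} {k : K}

theorem RunsLE.mono (h : RunsLE p S m S') (hmn : m ≤ n) : RunsLE p S n S' :=
  h.imp fun _ h => ⟨h.1.trans hmn, h.2⟩

theorem RunsLE.skip : RunsLE skip S 1 S := ⟨1, le_rfl, .skip S⟩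

theorem RunsLE.push {a : Γ k} (h : Function.update S k (a :: S k) = S') :
    RunsLE (push k a) S 1 S' :=
  ⟨1, le_rfl, h ▸ .push k a S⟩

theorem RunsLE.seq (hp : RunsLE p S m S') (hq : RunsLE q S' n S'') :
    RunsLE (seq p q) S (m + n) S'' := by
  obtain ⟨m', hm, hp⟩ := hp
  obtain ⟨n', hn, hq⟩ := hq
  exact ⟨m' + n', Nat.add_le_add hm hn, hp.seq hq⟩

theorem RunsLE.ite_nil (hS : S k = []) (h : RunsLE p S n S') :
    RunsLE (ite k p q) S (1 + n) S' := by
  obtain ⟨n', hn, h⟩ := h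
  exact ⟨1 + n', Nat.add_le_add_left hn 1, h.ite_nil hS⟩

theorem RunsLE.ite_cons (hS : S k ≠ []) (h : RunsLE q S n S') :
    RunsLE (ite k p q) S (1 + n) S' := by
  obtain ⟨n', hn, h⟩ := h
  exact ⟨1 + n', Nat.add_le_add_left hn 1, h.ite_cons hS⟩

variable {body : Γ k → StackProg Γ}

theorem RunsLE.loop_nil (hS : S k = []) : RunsLE (loop k body) S 1 S := ⟨1, le_rfl, .loop_nil hS⟩

theorem RunsLE.loop_cons {a : Γ k} {l : List (Γ k)} (hS : S k = a :: l)
    (hb : RunsLE (body a) (Function.update S k l) m S') (hl : RunsLE (loop k body) S' n S'') :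
    RunsLE (loop k body) S (1 + m + n) S'' := by
  obtain ⟨m', hm, hb⟩ := hb
  obtain ⟨n', hn, hl⟩ := hl
  exact ⟨1 + m' + n', by omega, hb.loop_cons hS hl⟩

/-- The form used in inductions: the stacks after the pop may be presented as any equal family `T`,
and the arithmetic of the bound is a separate goal. -/
theorem RunsLE.loop_step {T : ∀ k, List (Γ k)} {N : ℕ} {a : Γ k} {l : List (Γ k)}
    (hS : S k = a :: l) (hT : Function.update S k l = T) (hb : RunsLE (body a) T m S')
    (hl : RunsLE (loop k body) S' n S'') (hN : 1 + m + n ≤ N) : RunsLE (loop k body) S N S'' :=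
  (RunsLE.loop_cons hS (hT ▸ hb) hl).mono hN

end Rules

end StackProg

/-! ### The program computing the reduction -/

/-- The stacks of the program: the input, the output, the reversed input graph, three counters,
the bits of the current row, and a copy of them. -/
inductive RedStack : Type
  | inp | out | rev | i | j | t | a | b
  deriving DecidableEq

namespace RedStack

instance : Fintype RedStack :=
  ⟨{inp, out, rev, i, j, t, a, b}, fun k => by cases k <;> decide⟩

/-- The alphabets of the stacks. -/
def Alph : RedStack → Type
  | inp => Option GraphSymbol
  | out => Option PartSymbol
  | rev => GraphSymbol
  | i | j | t => Unit
  | a | b => Bool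

instance : ∀ k, Finite (Alph k)
  | inp => inferInstanceAs (Finite (Option GraphSymbol))
  | out => inferInstanceAs (Finite (Option PartSymbol))
  | rev => inferInstanceAs (Finite GraphSymbol)
  | i | j | t => inferInstanceAs (Finite Unit)
  | a | b => inferInstanceAs (Finite Bool)

/-- The contents of the stacks. -/
def store (x : List GraphSymbol × ℕ) (w : List PartSymbol × ℕ) (rv : List GraphSymbol)
    (ni nj nt : ℕ) (as bs : List Bool) : ∀ k, List (Alph k)
  | inp => encodeInstance x
  | out => encodeInstance w
  | rev => rv
  | i => List.replicate ni ()
  | j => List.replicate nj ()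
  | t => List.replicate nt ()
  | a => as
  | b => bs

end RedStack

/-- The symbol for an adjacency bit in the word of a graph with a partition. -/
abbrev PartSymbol.bit (b : Bool) : PartSymbol := .sym (.bit b)

/-- The symbol for a vertex in the word of a graph with a partition. -/
abbrev PartSymbol.vertex : PartSymbol := .sym .vertex

/-- The adjacency bits of a copy of a vertex `v` with the copies of a vertex `u`. -/
def copyBlock (i j : ℕ) (b : Bool) : List PartSymbol :=
  List.replicate i (.bit b) ++ .bit true :: List.replicate j (.bit b)

/-- The code of the `i`-th of `i + j + 1` copies of a vertex with adjacency bits `bs`. -/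
def copyRow (i j : ℕ) (bs : List Bool) : List PartSymbol :=
  .vertex :: (List.replicate (i + 1) .clique ++ (List.replicate (i + j) (.bit true) ++
    (bs.flatMap (copyBlock i j) ++ List.replicate i (.bit true))))

/-- The code of all copies of a vertex with adjacency bits `bs`. -/
def copyRows (k : ℕ) (bs : List Bool) : List PartSymbol :=
  (List.range (k + 1)).flatMap fun i => copyRow i (k - i) bs

/-- The code of the `i`-th of the additional independent vertices. -/
def freshRow (i : ℕ) : List PartSymbol :=
  .vertex :: (List.replicate (i + 1) .clique ++ List.replicate i (.bit false))

/-- Split a word into leading bits and rows, each of which starts with a vertex. -/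
def parseRows : List GraphSymbol → List Bool × List (List Bool)
  | [] => ([], [])
  | .bit b :: x => (b :: (parseRows x).1, (parseRows x).2)
  | .vertex :: x => ([], (parseRows x).1 :: (parseRows x).2)

/-- The word of the graph to which an instance is reduced. -/
def reductionWord (x : List GraphSymbol) (k : ℕ) : List PartSymbol :=
  (parseRows x).1.reverse.map .bit ++ ((List.range k).flatMap freshRow ++
    (parseRows x).2.flatMap (copyRows k))

/-- The reduction. -/
def reduction (I : List GraphSymbol × ℕ) : List PartSymbol × ℕ :=
  if I.2 = 0 ∨ I.1 = [] then ([], 0) else (reductionWord I.1 I.2, I.2 + 1)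

theorem length_parseRows_fst_le (x : List GraphSymbol) : (parseRows x).1.length ≤ x.length := by
  fun_induction parseRows x <;> simp_all

namespace RedStack

open StackProg

/-- Output `c` once for each element of the counter `i`. -/
def emitI (c : PartSymbol) : StackProg Alph :=
  .seq (.loop i fun _ => .seq (.push t ()) (.push out (some c))) (.loop t fun _ => .push i ())

/-- Output `c` once for each element of the counter `j`. -/
def emitJ (c : PartSymbol) : StackProg Alph :=
  .seq (.loop j fun _ => .seq (.push t ()) (.push out (some c))) (.loop t fun _ => .push j ())

/-- Output a `copyBlock`. -/
def emitBlock (c : Bool) : StackProg Alph :=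
  .seq (emitJ (.bit c)) (.seq (.push out (some (.bit true))) (emitI (.bit c)))

/-- Output a `copyRow`. -/
def emitRow : StackProg Alph :=
  .seq (emitI (.bit true)) <| .seq (.loop a fun c => .push b c) <|
    .seq (.loop b fun c => .seq (.push a c) (emitBlock c)) <| .seq (emitI (.bit true)) <|
    .seq (emitJ (.bit true)) <| .seq (emitI .clique) <|
    .seq (.push out (some .clique)) (.push out (some .vertex))

/-- Output all copies of a vertex. -/
def emitRows : StackProg Alph :=
  .seq emitRow <| .seq (.loop i fun _ => .seq (.push j ()) emitRow) <|
    .seq (.loop j fun _ => .push i ()) (.loop a fun _ => .skip)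

/-- Output the additional independent vertices. -/
def emitFresh : StackProg Alph :=
  .loop i fun _ => .seq (.push j ()) <| .seq (emitI (.bit false)) <| .seq (emitI .clique) <|
    .seq (.push out (some .clique)) (.push out (some .vertex))

/-- Process the input graph. -/
def emitCopies : StackProg Alph :=
  .loop rev fun g => match g with
    | .bit c => .push a c
    | .vertex => emitRows

/-- Output the graph and the parameter. -/
def emitAll : StackProg Alph :=
  .seq emitCopies <| .seq emitFresh <| .seq (.loop a fun c => .push out (some (.bit c))) <|
    .seq (.loop j fun _ => .push out none) (.push out none)

/-- Separate the parameter from the graph. -/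
def readInput : StackProg Alph :=
  .loop inp fun o => match o with
    | none => .push i ()
    | some g => .push rev g

/-- The program computing the reduction. -/
def prog : StackProg Alph :=
  .seq readInput <| .ite i (.loop rev fun _ => .skip) <| .ite rev (.loop i fun _ => .skip) emitAll

/-! ### Effect and running time of the program for the reduction -/

variable {x : List GraphSymbol × ℕ} {w : List PartSymbol} {h : ℕ} {rv : List GraphSymbol}
  {ni nj nt : ℕ} {as bs : List Bool}

/-- The parameter precedes the word in `encodeInstance`, so a symbol can be put in front of the word
only while no parameter symbol has been written. -/
theorem runs_push_out (c : PartSymbol) :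
    RunsLE (.push out (some c)) (store x (w, 0) rv ni nj nt as bs) 1
      (store x (c :: w, 0) rv ni nj nt as bs) :=
  .push (by funext k; cases k <;> rfl)

theorem runs_push_none :
    RunsLE (.push out none) (store x (w, h) rv ni nj nt as bs) 1
      (store x (w, h + 1) rv ni nj nt as bs) :=
  .push (by funext k; cases k <;> rfl)

theorem runs_push_rev (g : GraphSymbol) :
    RunsLE (.push rev g) (store x (w, h) rv ni nj nt as bs) 1
      (store x (w, h) (g :: rv) ni nj nt as bs) :=
  .push (by funext k; cases k <;> rfl)

theorem runs_push_i :
    RunsLE (.push i ()) (store x (w, h) rv ni nj nt as bs) 1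
      (store x (w, h) rv (ni + 1) nj nt as bs) :=
  .push (by funext k; cases k <;> rfl)

theorem runs_push_j :
    RunsLE (.push j ()) (store x (w, h) rv ni nj nt as bs) 1
      (store x (w, h) rv ni (nj + 1) nt as bs) :=
  .push (by funext k; cases k <;> rfl)

theorem runs_push_t :
    RunsLE (.push t ()) (store x (w, h) rv ni nj nt as bs) 1
      (store x (w, h) rv ni nj (nt + 1) as bs) :=
  .push (by funext k; cases k <;> rfl)

theorem runs_push_a (c : Bool) :
    RunsLE (.push a c) (store x (w, h) rv ni nj nt as bs) 1
      (store x (w, h) rv ni nj nt (c :: as) bs) :=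
  .push (by funext k; cases k <;> rfl)

theorem runs_push_b (c : Bool) :
    RunsLE (.push b c) (store x (w, h) rv ni nj nt as bs) 1
      (store x (w, h) rv ni nj nt as (c :: bs)) :=
  .push (by funext k; cases k <;> rfl)

/-- A counter can be read only by emptying it; its units are parked on `t` and then moved back. -/
theorem runs_emitI (c : PartSymbol) :
    RunsLE (emitI c) (store x (w, 0) rv ni nj 0 as bs) (5 * ni + 2)
      (store x (List.replicate ni c ++ w, 0) rv ni nj 0 as bs) := by
  have h₁ : ∀ n m w, RunsLE (.loop i fun _ => .seq (.push t ()) (.push out (some c)))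
      (store x (w, 0) rv n nj m as bs) (3 * n + 1)
      (store x (List.replicate n c ++ w, 0) rv 0 nj (m + n) as bs) := by
    intro n
    induction n with
    | zero => intro m w; exact .loop_nil rfl
    | succ n ih =>
      intro m w
      have := ih (m + 1) (c :: w)
      rw [List.replicate_succ', List.append_assoc, List.singleton_append, ← Nat.add_assoc,
        Nat.add_right_comm]
      exact .loop_step rfl (by funext k; cases k <;> rfl) (runs_push_t.seq (runs_push_out c)) this
        (by omega)
  have h₂ : ∀ n m w, RunsLE (.loop t fun _ => .push i ())
      (store x (w, 0) rv m nj n as bs) (2 * n + 1)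
      (store x (w, 0) rv (m + n) nj 0 as bs) := by
    intro n
    induction n with
    | zero => intro m w; exact .loop_nil rfl
    | succ n ih =>
      intro m w
      have := ih (m + 1) w
      rw [← Nat.add_assoc, Nat.add_right_comm]
      exact .loop_step rfl (by funext k; cases k <;> rfl) runs_push_i this (by omega)
  have := (h₁ ni 0 w).seq (h₂ (0 + ni) 0 _)
  rw [Nat.zero_add, Nat.zero_add] at this
  exact this.mono (by omega)

theorem runs_emitJ (c : PartSymbol) :
    RunsLE (emitJ c) (store x (w, 0) rv ni nj 0 as bs) (5 * nj + 2)
      (store x (List.replicate nj c ++ w, 0) rv ni nj 0 as bs) := by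
  have h₁ : ∀ n m w, RunsLE (.loop j fun _ => .seq (.push t ()) (.push out (some c)))
      (store x (w, 0) rv ni n m as bs) (3 * n + 1)
      (store x (List.replicate n c ++ w, 0) rv ni 0 (m + n) as bs) := by
    intro n
    induction n with
    | zero => intro m w; exact .loop_nil rfl
    | succ n ih =>
      intro m w
      have := ih (m + 1) (c :: w)
      rw [List.replicate_succ', List.append_assoc, List.singleton_append, ← Nat.add_assoc,
        Nat.add_right_comm]
      exact .loop_step rfl (by funext k; cases k <;> rfl) (runs_push_t.seq (runs_push_out c)) this
        (by omega)
  have h₂ : ∀ n m w, RunsLE (.loop t fun _ => .push j ())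
      (store x (w, 0) rv ni m n as bs) (2 * n + 1)
      (store x (w, 0) rv ni (m + n) 0 as bs) := by
    intro n
    induction n with
    | zero => intro m w; exact .loop_nil rfl
    | succ n ih =>
      intro m w
      have := ih (m + 1) w
      rw [← Nat.add_assoc, Nat.add_right_comm]
      exact .loop_step rfl (by funext k; cases k <;> rfl) runs_push_j this (by omega)
  have := (h₁ nj 0 w).seq (h₂ (0 + nj) 0 _)
  rw [Nat.zero_add, Nat.zero_add] at this
  exact this.mono (by omega)

theorem runs_emitBlock (c : Bool) :
    RunsLE (emitBlock c) (store x (w, 0) rv ni nj 0 as bs) (5 * (ni + nj) + 5)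
      (store x (copyBlock ni nj c ++ w, 0) rv ni nj 0 as bs) := by
  have := (runs_emitJ (.bit c)).seq ((runs_push_out (.bit true)).seq (runs_emitI (.bit c)))
    (S := store x (w, 0) rv ni nj 0 as bs)
  rw [copyBlock, List.append_assoc, List.cons_append]
  exact this.mono (by omega)

/-- A bound for the running time of `emitRow`. -/
def rowTime (k n : ℕ) : ℕ := n * (5 * k + 9) + (20 * k + 12)

/-- The output is a stack, so a row is written from its end to its beginning. Moving the bits from
`a` to `b` reverses them; the second loop then meets the last bit first and at the same time
restores `a` for the next copy. -/
theorem runs_emitRow :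
    RunsLE emitRow (store x (w, 0) rv ni nj 0 as []) (rowTime (ni + nj) as.length)
      (store x (copyRow ni nj as ++ w, 0) rv ni nj 0 as []) := by
  have h₁ : ∀ as bs w, RunsLE (.loop a fun c => .push b c)
      (store x (w, 0) rv ni nj 0 as bs) (2 * as.length + 1)
      (store x (w, 0) rv ni nj 0 [] (as.reverse ++ bs)) := by
    intro as
    induction as with
    | nil => intro bs w; exact .loop_nil rfl
    | cons c as ih =>
      intro bs w
      have := ih (c :: bs) w
      rw [List.reverse_cons, List.append_assoc, List.singleton_append, List.length_cons]
      exact .loop_step rfl (by funext k; cases k <;> rfl) (runs_push_b c) this (by omega)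
  have h₂ : ∀ bs as w, RunsLE (.loop b fun c => .seq (.push a c) (emitBlock c))
      (store x (w, 0) rv ni nj 0 as bs) (bs.length * (5 * (ni + nj) + 7) + 1)
      (store x (bs.reverse.flatMap (copyBlock ni nj) ++ w, 0) rv ni nj 0 (bs.reverse ++ as) []) := by
    intro bs
    induction bs with
    | nil => intro as w; exact RunsLE.mono (.loop_nil rfl) (Nat.le_add_left 1 _)
    | cons c bs ih =>
      intro as w
      have := ih (c :: as) (copyBlock ni nj c ++ w)
      rw [List.reverse_cons, List.append_assoc, List.singleton_append, List.flatMap_append,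
        List.flatMap_singleton, List.append_assoc, List.length_cons]
      exact .loop_step rfl (by funext k; cases k <;> rfl)
        ((runs_push_a c).seq (runs_emitBlock c)) this (by ring_nf; omega)
  have h₃ := h₁ as [] (List.replicate ni (.bit true) ++ w)
  have h₄ := h₂ as.reverse [] (List.replicate ni (.bit true) ++ w)
  rw [List.append_nil] at h₃
  rw [List.append_nil, List.reverse_reverse, List.length_reverse] at h₄
  have := (runs_emitI (.bit true)).seq <| h₃.seq <| h₄.seq <| (runs_emitI (.bit true)).seq <|
    (runs_emitJ (.bit true)).seq <| (runs_emitI .clique).seq <| (runs_push_out .clique).seq <|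
    (runs_push_out .vertex)
  refine (show copyRow ni nj as ++ w = _ from ?_) ▸ this.mono ?_
  -- The `i + j` bits for the fresh vertices are written as `i` bits followed by `j` bits in front
  -- of them.
  · rw [copyRow, Nat.add_comm ni nj, List.replicate_add nj]
    simp only [List.append_assoc, List.cons_append, List.replicate_succ]
  · unfold rowTime; ring_nf; omega

theorem runs_clear_a :
    RunsLE (.loop a fun _ => .skip) (store x (w, h) rv ni nj nt as bs) (2 * as.length + 1)
      (store x (w, h) rv ni nj nt [] bs) := by
  induction as with
  | nil => exact .loop_nil rfl
  | cons c as ih =>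
    exact .loop_step rfl (by funext k; cases k <;> rfl) .skip ih (by grind)

theorem runs_clear_rev :
    RunsLE (.loop rev fun _ => .skip) (store x (w, h) rv ni nj nt as bs) (2 * rv.length + 1)
      (store x (w, h) [] ni nj nt as bs) := by
  induction rv with
  | nil => exact .loop_nil rfl
  | cons c as ih =>
    exact .loop_step rfl (by funext k; cases k <;> rfl) .skip ih (by grind)

theorem runs_clear_i :
    RunsLE (.loop i fun _ => .skip) (store x (w, h) rv ni nj nt as bs) (2 * ni + 1)
      (store x (w, h) rv 0 nj nt as bs) := by
  induction ni with
  | zero => exact .loop_nil rfl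
  | succ n ih =>
    exact .loop_step rfl (by funext k; cases k <;> rfl) .skip ih (by omega)

theorem runs_move_j :
    RunsLE (.loop j fun _ => .push i ()) (store x (w, h) rv ni nj nt as bs) (2 * nj + 1)
      (store x (w, h) rv (ni + nj) 0 nt as bs) := by
  induction nj generalizing ni with
  | zero => exact .loop_nil rfl
  | succ n ih =>
    have := ih (ni := ni + 1)
    rw [← Nat.add_assoc, Nat.add_right_comm]
    exact .loop_step rfl (by funext k; cases k <;> rfl) runs_push_i this (by omega)

/-- A bound for the running time of `emitRows`. -/
def rowsTime (k n : ℕ) : ℕ := (k + 1) * (rowTime k n + 2) + (2 * k + 2 * n + 3)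

theorem runs_emitRows (k : ℕ) :
    RunsLE emitRows (store x (w, 0) rv k 0 0 as []) (rowsTime k as.length)
      (store x (copyRows k as ++ w, 0) rv k 0 0 [] []) := by
  -- The copies are written from the last to the first; each iteration moves one unit from `i` to
  -- `j`, which keeps the sum `k`.
  have h₁ : ∀ n m w, n + m = k → RunsLE (.loop i fun _ => .seq (.push j ()) emitRow)
      (store x (w, 0) rv n m 0 as []) (n * (rowTime k as.length + 2) + 1)
      (store x ((List.range n).flatMap (fun i => copyRow i (k - i) as) ++ w, 0) rv 0 k 0 as []) := by
    intro n
    induction n with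
    | zero =>
      intro m w hm
      rw [← hm, Nat.zero_add]
      exact RunsLE.mono (.loop_nil rfl) (Nat.le_add_left 1 _)
    | succ n ih =>
      intro m w hm
      have h := ih (m + 1) (copyRow n (m + 1) as ++ w) (by omega)
      have h' := runs_push_j.seq (runs_emitRow (x := x) (w := w) (rv := rv) (ni := n) (nj := m + 1)
        (as := as))
      rw [← Nat.add_assoc, Nat.add_right_comm, hm] at h'
      rw [List.range_succ, List.flatMap_append, List.flatMap_singleton, List.append_assoc,
        show k - n = m + 1 by omega]
      exact .loop_step rfl (by funext k; cases k <;> rfl) h' h (by ring_nf; omega)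
  have := runs_emitRow.seq <| (h₁ k 0 (copyRow k 0 as ++ w) rfl).seq <|
    runs_move_j.seq runs_clear_a
  rw [Nat.zero_add, ← List.append_assoc] at this
  rw [copyRows, List.range_succ, List.flatMap_append, List.flatMap_singleton, Nat.sub_self]
  exact this.mono (by unfold rowsTime; ring_nf; omega)

/-- The counter `j` is left at `k`, ready for writing the new parameter. -/
theorem runs_emitFresh (k : ℕ) :
    RunsLE emitFresh (store x (w, 0) rv k 0 0 as bs) (k * (10 * k + 9) + 1)
      (store x ((List.range k).flatMap freshRow ++ w, 0) rv 0 k 0 as bs) := by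
  have h₁ : ∀ n m w, n + m = k → RunsLE emitFresh
      (store x (w, 0) rv n m 0 as bs) (n * (10 * k + 9) + 1)
      (store x ((List.range n).flatMap freshRow ++ w, 0) rv 0 k 0 as bs) := by
    intro n
    induction n with
    | zero =>
      intro m w hm
      rw [← hm, Nat.zero_add]
      exact RunsLE.mono (.loop_nil rfl) (Nat.le_add_left 1 _)
    | succ n ih =>
      intro m w hm
      have h := ih (m + 1) (freshRow n ++ w) (by omega)
      rw [List.range_succ, List.flatMap_append, List.flatMap_singleton, List.append_assoc]
      have h' := runs_push_j.seq <| (runs_emitI (.bit false)).seq <| (runs_emitI .clique).seq <|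
        (runs_push_out .clique).seq <| runs_push_out .vertex
        (x := x) (w := .clique :: (List.replicate n .clique ++ (List.replicate n (.bit false) ++ w)))
        (rv := rv) (ni := n) (nj := m + 1) (nt := 0) (as := as) (bs := bs)
      have h₀ : freshRow n ++ w = .vertex :: .clique ::
          (List.replicate n .clique ++ (List.replicate n (.bit false) ++ w)) := by
        simp [freshRow, List.replicate_succ]
      rw [h₀] at h ⊢
      refine .loop_step rfl (by funext k; cases k <;> rfl) h' h ?_
      rw [Nat.add_mul]
      omega
  exact h₁ k 0 w rfl

theorem runs_readInput (x : List GraphSymbol) (k : ℕ) :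
    RunsLE readInput (store (x, k) (w, h) [] 0 nj nt as bs) (2 * (x.length + k) + 1)
      (store ([], 0) (w, h) x.reverse k nj nt as bs) := by
  have h₁ : ∀ x rv, RunsLE readInput (store (x, 0) (w, h) rv k nj nt as bs) (2 * x.length + 1)
      (store ([], 0) (w, h) (x.reverse ++ rv) k nj nt as bs) := by
    intro x
    induction x with
    | nil => intro rv; exact .loop_nil rfl
    | cons g x ih =>
      intro rv
      have := ih (g :: rv)
      rw [List.reverse_cons, List.append_assoc, List.singleton_append, List.length_cons]
      exact .loop_step rfl (by funext k; cases k <;> rfl) (runs_push_rev g) this (by omega)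
  have h₂ : ∀ n m, m + n = k → RunsLE readInput (store (x, n) (w, h) [] m nj nt as bs)
      (2 * (x.length + n) + 1) (store ([], 0) (w, h) x.reverse k nj nt as bs) := by
    intro n
    induction n with
    | zero => rintro m rfl; exact (List.append_nil x.reverse) ▸ h₁ x []
    | succ n ih =>
      intro m hm
      exact .loop_step rfl (by funext k; cases k <;> rfl) runs_push_i (ih (m + 1) (by omega))
        (by omega)
  exact h₂ k 0 (Nat.zero_add k)

theorem rowsTime_mono (k : ℕ) : Monotone (rowsTime k) := by
  intro m n h
  unfold rowsTime rowTime
  gcongr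

theorem runs_emitCopies (k N : ℕ) (y : List GraphSymbol) (hN : y.length ≤ N) :
    RunsLE emitCopies (store x ([], 0) y.reverse k 0 0 [] []) (N * (rowsTime k N + 2) + 1)
      (store x ((parseRows y).2.flatMap (copyRows k), 0) [] k 0 0 (parseRows y).1 []) := by
  have h₁ : ∀ r z : List GraphSymbol, r.length + z.length ≤ N → RunsLE emitCopies
      (store x ((parseRows z).2.flatMap (copyRows k), 0) r k 0 0 (parseRows z).1 [])
      (r.length * (rowsTime k N + 2) + 1)
      (store x ((parseRows (r.reverse ++ z)).2.flatMap (copyRows k), 0) [] k 0 0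
        (parseRows (r.reverse ++ z)).1 []) := by
    intro r
    induction r with
    | nil => intro z _; exact RunsLE.mono (.loop_nil rfl) (Nat.le_add_left 1 _)
    | cons g r ih =>
      intro z hz
      rw [List.length_cons] at hz ⊢
      have := ih (g :: z) (by rw [List.length_cons]; omega)
      rw [List.reverse_cons, List.append_assoc, List.singleton_append]
      cases g with
      | bit c =>
        exact .loop_step rfl (by funext k; cases k <;> rfl) (runs_push_a c) this
          (by ring_nf; omega)
      | vertex =>
        have hz' := rowsTime_mono k ((length_parseRows_fst_le z).trans (by omega : _ ≤ N))
        exact .loop_step rfl (by funext k; cases k <;> rfl) ((runs_emitRows k).mono hz') this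
          (by ring_nf; omega)
  have := h₁ y.reverse [] (by simpa using hN)
  rw [List.reverse_reverse, List.append_nil] at this
  refine this.mono ?_
  rw [List.length_reverse]
  gcongr

/-- Bits left on `a` belong to no vertex and occur only in malformed words. They are written too, in
reverse, which keeps the output malformed. The final push raises the parameter from `k` to `k + 1`.
-/
theorem runs_emitAll (k N : ℕ) (y : List GraphSymbol) (hN : y.length ≤ N) :
    RunsLE emitAll (store x ([], 0) y.reverse k 0 0 [] [])
      (N * (rowsTime k N + 2) + k * (10 * k + 9) + 2 * N + 2 * k + 5)
      (store x (reductionWord y k, k + 1) [] 0 0 0 [] []) := by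
  have h₁ : ∀ as w, RunsLE (.loop a fun c => .push out (some (.bit c)))
      (store x (w, 0) [] 0 k 0 as []) (2 * as.length + 1)
      (store x (as.reverse.map .bit ++ w, 0) [] 0 k 0 [] []) := by
    intro as
    induction as with
    | nil => intro w; exact .loop_nil rfl
    | cons c as ih =>
      intro w
      have := ih (.bit c :: w)
      rw [List.reverse_cons, List.map_append, List.append_assoc, List.map_singleton,
        List.singleton_append, List.length_cons]
      exact .loop_step rfl (by funext k; cases k <;> rfl) (runs_push_out _) this (by omega)
  have h₂ : ∀ n m w, RunsLE (.loop j fun _ => .push out none)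
      (store x (w, m) [] 0 n 0 [] []) (2 * n + 1)
      (store x (w, m + n) [] 0 0 0 [] []) := by
    intro n
    induction n with
    | zero => intro m w; exact .loop_nil rfl
    | succ n ih =>
      intro m w
      have := ih (m + 1) w
      rw [← Nat.add_assoc, Nat.add_right_comm]
      exact .loop_step rfl (by funext k; cases k <;> rfl) runs_push_none this (by omega)
  have := (runs_emitCopies (x := x) k N y hN).seq <| (runs_emitFresh k).seq <|
    (h₁ _ _).seq <| (h₂ k 0 _).seq runs_push_none
  rw [Nat.zero_add] at this
  have hy := (length_parseRows_fst_le y).trans hN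
  exact this.mono (by omega)

/-- A bound for the running time of `prog`. -/
def progTime (k N : ℕ) : ℕ :=
  N * (rowsTime k N + 2) + k * (10 * k + 9) + 4 * N + 4 * k + 8

theorem runs_prog (I : List GraphSymbol × ℕ) :
    RunsLE prog (store I ([], 0) [] 0 0 0 [] []) (progTime I.2 I.1.length)
      (store ([], 0) (reduction I) [] 0 0 0 [] []) := by
  obtain ⟨y, k⟩ := I
  unfold reduction progTime
  by_cases hk : k = 0
  · subst hk
    rw [if_pos (Or.inl rfl)]
    refine ((runs_readInput y 0).seq (.ite_nil rfl runs_clear_rev)).mono ?_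
    rw [List.length_reverse]
    dsimp only
    omega
  · have hk' : List.replicate k () ≠ [] := by simpa using hk
    by_cases hy : y = []
    · subst hy
      rw [if_pos (Or.inr rfl)]
      refine ((runs_readInput [] k).seq (.ite_cons (k := i) hk' (.ite_nil (k := rev) rfl runs_clear_i))).mono ?_
      dsimp only [List.length_nil]
      omega
    · rw [if_neg (by simp [hk, hy])]
      have hy' : y.reverse ≠ [] := by simpa using hy
      refine ((runs_readInput y k).seq
        (.ite_cons (k := i) hk' (.ite_cons (k := rev) hy' (runs_emitAll k y.length y le_rfl)))).mono ?_
      dsimp only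
      omega

/-- At most `N` vertices have `k + 1` copies each, and a row costs on the order of `N * k` steps:
degree four in total. After both arguments are replaced by `u = N + k`, the polynomials are compared
in one variable. -/
theorem progTime_le (k N : ℕ) : progTime k N + 1 ≤ 100 * (N + k + 1) ^ 4 := by
  obtain ⟨u, hu⟩ : ∃ u, u = N + k := ⟨_, rfl⟩
  have hk : k ≤ u := by omega
  have hN : N ≤ u := by omega
  have h : progTime k N ≤ progTime u u := by
    unfold progTime rowsTime rowTime
    gcongr
  rw [← hu]
  refine (Nat.succ_le_succ h).trans ?_
  unfold progTime rowsTime rowTime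
  ring_nf
  nlinarith [Nat.zero_le u, Nat.zero_le (u ^ 2), Nat.zero_le (u ^ 3), Nat.zero_le (u ^ 4)]

end RedStack

theorem isFptComputable_reduction : IsFptComputable reduction := by
  refine ⟨⟨StackProg.machine .inp .out RedStack.prog, .refl _, .refl _⟩, fun _ => 100, 4,
    Computable.const 100, fun I => ?_⟩
  have h₀ : RedStack.store I ([], 0) [] 0 0 0 [] [] =
      Function.update (β := fun k => List (RedStack.Alph k)) (fun _ => []) RedStack.inp (encodeInstance I) := by
    funext k; cases k <;> rfl
  have h₁ : RedStack.store ([], 0) (reduction I) [] 0 0 0 [] [] =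
      Function.update (β := fun k => List (RedStack.Alph k)) (fun _ => []) RedStack.out (encodeInstance (reduction I)) := by
    funext k; cases k <;> rfl
  have h := RedStack.runs_prog I
  rw [h₀, h₁] at h
  obtain ⟨h⟩ := h.outputsInTime
  have h₂ : List.map (Equiv.refl (Option GraphSymbol)).symm (encodeInstance I) =
    encodeInstance I := List.map_id _
  have h₃ : List.map (Equiv.refl (Option PartSymbol)).symm (encodeInstance (reduction I)) =
    encodeInstance (reduction I) := List.map_id _
  exact ⟨⟨⟨h.steps, by
    refine Eq.trans (congrArg _ ?_) (h.evals_in_steps.trans ?_)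
    · exact congrArg (fun l => some (Turing.initList _ l)) h₂
    · exact congrArg (fun l => some (Turing.haltList _ l)) h₃.symm⟩,
    h.steps_le_m.trans (RedStack.progTime_le _ _)⟩⟩

/-! ### Well-covered graphs -/

section WellCovered

variable {V W : Type*}

theorem SimpleGraph.IsIndepSet.exists_maximal_finset [Finite V] {G : SimpleGraph V} {s : Finset V}
    (hs : G.IsIndepSet (s : Set V)) :
    ∃ t : Finset V, s ⊆ t ∧ Maximal G.IsIndepSet (t : Set V) := by
  obtain ⟨t, hst, ht⟩ := (Set.toFinite {t : Set V | G.IsIndepSet t}).exists_le_maximal hs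
  have := Fintype.ofFinite V
  classical
  exact ⟨t.toFinset, by simpa [Set.subset_toFinset] using hst, by simpa using ht⟩

theorem exists_maximal_indepSet [Finite V] (G : SimpleGraph V) :
    ∃ t : Finset V, Maximal G.IsIndepSet (t : Set V) := by
  obtain ⟨t, -, ht⟩ := SimpleGraph.IsIndepSet.exists_maximal_finset (G := G) (s := ∅) (by simp)
  exact ⟨t, ht⟩

/-- An independent set is maximal if each other vertex has a neighbour in it. -/
theorem maximal_isIndepSet_iff {G : SimpleGraph V} {s : Set V} :
    Maximal G.IsIndepSet s ↔ G.IsIndepSet s ∧ ∀ v ∉ s, ∃ u ∈ s, G.Adj u v := by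
  constructor
  · refine fun h => ⟨h.1, fun v hv => ?_⟩
    by_contra! hu
    refine hv (h.2 (y := insert v s) ?_ (Set.subset_insert v s) (Set.mem_insert v s))
    exact (Set.pairwise_insert.2
      ⟨h.1, fun u hus _ => ⟨fun h' => hu u hus h'.symm, hu u hus⟩⟩)
  · refine fun h => ⟨h.1, fun t ht hst v hv => ?_⟩
    by_contra hvs
    obtain ⟨u, hu, huv⟩ := h.2 v hvs
    exact ht (hst hu) hv huv.ne huv

/-- All maximum sets have the same size, which the given set fixes as `k`. Conversely, every
independent set extends to a maximal one, so none has more than `k` elements. -/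
theorem isWellCovered_iff_of_exists [Finite V] {G : SimpleGraph V} {k : ℕ}
    (h : ∃ s : Finset V, Maximal G.IsIndepSet (s : Set V) ∧ s.card = k) :
    IsWellCovered G ↔ IsKWellCovered G k := by
  obtain ⟨s, hs, rfl⟩ := h
  constructor
  · exact fun hG t ht => le_antisymm ((hG s hs).maximum t ht.1) ((hG t ht).maximum s hs.1)
  · refine fun hG t ht => ⟨ht.1, fun u hu => ?_⟩
    obtain ⟨u', huu', hu'⟩ := hu.exists_maximal_finset
    rw [hG t ht, ← hG u' hu']
    exact Finset.card_le_card huu'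

theorem not_isKWellCovered_zero [Finite V] [Nonempty V] (G : SimpleGraph V) :
    ¬ IsKWellCovered G 0 := by
  obtain ⟨s, hs⟩ := exists_maximal_indepSet G
  intro h
  obtain rfl := Finset.card_eq_zero.1 (h s hs)
  obtain ⟨v⟩ := ‹Nonempty V›
  obtain ⟨u, hu, -⟩ := (maximal_isIndepSet_iff.1 hs).2 v (by simp)
  simp at hu

theorem maximal_isIndepSet_map (e : V ≃ W) {G : SimpleGraph V} {H : SimpleGraph W}
    (he : ∀ a b, H.Adj (e a) (e b) ↔ G.Adj a b) {s : Finset V}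
    (hs : Maximal G.IsIndepSet (s : Set V)) :
    Maximal H.IsIndepSet (s.map e.toEmbedding : Set W) := by
  rw [maximal_isIndepSet_iff] at hs ⊢
  refine ⟨?_, fun w hw => ?_⟩
  · rintro _ ha _ hb hab
    obtain ⟨a, ha', rfl⟩ := Finset.mem_map.1 ha
    obtain ⟨b, hb', rfl⟩ := Finset.mem_map.1 hb
    exact fun h => hs.1 ha' hb' (fun h => hab (by rw [h])) ((he a b).1 h)
  · obtain ⟨v, rfl⟩ := e.surjective w
    obtain ⟨u, hu, huv⟩ := hs.2 v fun hv => hw (by simpa using hv)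
    exact ⟨e u, by simpa using hu, (he u v).2 huv⟩

theorem isKWellCovered_of_equiv (e : V ≃ W) {G : SimpleGraph V} {H : SimpleGraph W}
    (he : ∀ a b, H.Adj (e a) (e b) ↔ G.Adj a b) {k : ℕ} (h : IsKWellCovered H k) :
    IsKWellCovered G k := fun s hs => by
  simpa using h _ (maximal_isIndepSet_map e he hs)

/-! ### Copies of a graph -/

section CliqueCopies

variable {G : SimpleGraph V} {ℓ : ℕ}

/-- The three conditions negate the three clauses of adjacency in `cliqueCopies`. -/
theorem isIndepSet_cliqueCopies_iff {s : Set (Fin ℓ × V)} :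
    (cliqueCopies G ℓ).IsIndepSet s ↔
      s.InjOn Prod.fst ∧ s.InjOn Prod.snd ∧ G.IsIndepSet (Prod.snd '' s) := by
  constructor
  · refine fun h => ⟨fun p hp q hq hpq => ?_, fun p hp q hq hpq => ?_, ?_⟩
    · by_contra hne
      exact h hp hq hne ⟨hne, Or.inl hpq⟩
    · by_contra hne
      exact h hp hq hne ⟨hne, Or.inr (Or.inl hpq)⟩
    · rintro _ ⟨p, hp, rfl⟩ _ ⟨q, hq, rfl⟩ hne hadj
      have hpq : p ≠ q := fun h => hne (by rw [h])
      exact h hp hq hpq ⟨hpq, Or.inr (Or.inr hadj)⟩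
  · rintro ⟨h₁, h₂, h₃⟩ p hp q hq hne ⟨-, h | h | h⟩
    · exact hne (h₁ hp hq h)
    · exact hne (h₂ hp hq h)
    · exact h₃ ⟨p, hp, rfl⟩ ⟨q, hq, rfl⟩ h.ne h

theorem card_le_of_isIndepSet_cliqueCopies {s : Finset (Fin ℓ × V)}
    (hs : (cliqueCopies G ℓ).IsIndepSet (s : Set (Fin ℓ × V))) : s.card ≤ ℓ := by
  simpa using Finset.card_le_card_of_injOn (t := Finset.univ) Prod.fst (by simp)
    (isIndepSet_cliqueCopies_iff.1 hs).1

/-- An independent set of `G` with at most `ℓ` elements lifts to the copies. -/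
theorem exists_isIndepSet_cliqueCopies {t : Finset V} (ht : G.IsIndepSet (t : Set V))
    (hc : t.card ≤ ℓ) : ∃ s : Finset (Fin ℓ × V), s.card = t.card ∧
      Prod.snd '' (s : Set (Fin ℓ × V)) = t ∧
      (cliqueCopies G ℓ).IsIndepSet (s : Set (Fin ℓ × V)) := by
  -- The vertices of `t` are sent to pairwise different cliques.
  let c : t ↪ Fin ℓ := t.equivFin.toEmbedding.trans (Fin.castLEEmb hc)
  let f : t ↪ Fin ℓ × V := ⟨fun v => (c v, v), fun u v h => Subtype.ext (Prod.ext_iff.1 h).2⟩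
  have hf : Prod.snd '' ((Finset.univ.map f : Finset (Fin ℓ × V)) : Set (Fin ℓ × V)) = t := by
    ext v
    constructor
    · rintro ⟨p, hp, rfl⟩
      obtain ⟨u, -, rfl⟩ := Finset.mem_map.1 hp
      exact u.2
    · exact fun hv => ⟨f ⟨v, hv⟩, by simp, rfl⟩
  refine ⟨Finset.univ.map f, by simp, hf, isIndepSet_cliqueCopies_iff.2 ⟨?_, ?_, hf.symm ▸ ht⟩⟩
  · intro p hp q hq h
    obtain ⟨u, -, rfl⟩ := Finset.mem_map.1 hp
    obtain ⟨v, -, rfl⟩ := Finset.mem_map.1 hq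
    exact congrArg f (c.injective h)
  · intro p hp q hq h
    obtain ⟨u, -, rfl⟩ := Finset.mem_map.1 hp
    obtain ⟨v, -, rfl⟩ := Finset.mem_map.1 hq
    exact congrArg f (Subtype.ext h)

/-- A maximal independent set of `G` with at most `ℓ` elements lifts to the copies. -/
theorem exists_maximal_cliqueCopies {t : Finset V} (ht : Maximal G.IsIndepSet (t : Set V))
    (hc : t.card ≤ ℓ) : ∃ s : Finset (Fin ℓ × V), s.card = t.card ∧
      Maximal (cliqueCopies G ℓ).IsIndepSet (s : Set (Fin ℓ × V)) := by
  obtain ⟨s, hst, hs, hsi⟩ := exists_isIndepSet_cliqueCopies ht.1 hc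
  refine ⟨s, hst, maximal_isIndepSet_iff.2 ⟨hsi, fun p hp => ?_⟩⟩
  -- A copy of a vertex of `t` is dominated by the chosen copy of that vertex, any other vertex by a
  -- chosen copy of a neighbour.
  by_cases hpt : p.2 ∈ t
  · rw [← Finset.mem_coe, ← hs] at hpt
    obtain ⟨q, hq, hqp⟩ := hpt
    exact ⟨q, hq, fun h => hp (h ▸ hq), Or.inr (Or.inl hqp)⟩
  · obtain ⟨u, hu, hup⟩ := (maximal_isIndepSet_iff.1 ht).2 p.2 hpt
    rw [← hs] at hu
    obtain ⟨q, hq, rfl⟩ := hu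
    exact ⟨q, hq, fun h => hp (h ▸ hq), Or.inr (Or.inr hup)⟩

/-- A maximal independent set of the copies with fewer than `ℓ` elements projects to a maximal
independent set of `G`. -/
theorem maximal_image_snd_of_card_lt [DecidableEq V] {s : Finset (Fin ℓ × V)}
    (hs : Maximal (cliqueCopies G ℓ).IsIndepSet (s : Set (Fin ℓ × V))) (hc : s.card < ℓ) :
    Maximal G.IsIndepSet (s.image Prod.snd : Set V) := by
  rw [maximal_isIndepSet_iff] at hs ⊢
  rw [Finset.coe_image]
  refine ⟨(isIndepSet_cliqueCopies_iff.1 hs.1).2.2, fun v hv => ?_⟩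
  -- In a clique `i` that `s` misses, the copy of `v` can be dominated only through an edge of `G`.
  obtain ⟨i, hi⟩ : ∃ i, i ∉ s.image Prod.fst := by
    by_contra! h
    have := Finset.card_le_card (fun i _ => h i : Finset.univ ⊆ s.image Prod.fst)
    rw [Finset.card_univ, Fintype.card_fin] at this
    exact absurd (this.trans Finset.card_image_le) hc.not_ge
  obtain ⟨p, hp, -, h⟩ := hs.2 (i, v) fun h => hv ⟨_, h, rfl⟩
  rcases h with h | h | h
  · exact absurd (Finset.mem_image.2 ⟨p, hp, h⟩) hi
  · exact absurd ⟨p, hp, h⟩ hv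
  · exact ⟨p.2, ⟨p, hp, rfl⟩, h⟩

theorem isKWellCovered_cliqueCopies_iff [Finite V] {k : ℕ} :
    IsKWellCovered (cliqueCopies G (k + 1)) k ↔ IsKWellCovered G k := by
  classical
  constructor
  · intro h t ht
    -- If `t` is too large to lift, any `k + 1` of its elements lift, and extending the result gives
    -- a maximal set with more than `k` elements.
    rcases Nat.lt_or_ge (k + 1) t.card with hlt | hle
    · obtain ⟨u, hut, hu⟩ := Finset.exists_subset_card_eq hlt.le
      obtain ⟨s, hs, -, hsi⟩ := exists_isIndepSet_cliqueCopies (ht.1.mono hut) hu.le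
      obtain ⟨s', hss', hs'⟩ := hsi.exists_maximal_finset
      have := Finset.card_le_card hss'
      rw [h s' hs', hs, hu] at this
      omega
    · obtain ⟨s, hs, hsm⟩ := exists_maximal_cliqueCopies ht hle
      rw [← hs, h s hsm]
  · intro h s hs
    have hinj := (isIndepSet_cliqueCopies_iff.1 hs.1).2.1
    have hcard : (s.image Prod.snd).card = s.card := Finset.card_image_of_injOn hinj
    rcases (card_le_of_isIndepSet_cliqueCopies hs.1).lt_or_eq with hlt | heq
    · rw [← hcard, h _ (maximal_image_snd_of_card_lt hs hlt)]
    -- A set that meets all `k + 1` cliques would project to `k + 1` independent vertices of `G`,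
    -- but these lie in a maximal set of size `k`.
    · have hi := (isIndepSet_cliqueCopies_iff.1 hs.1).2.2
      rw [← Finset.coe_image] at hi
      obtain ⟨t, hst, ht⟩ := hi.exists_maximal_finset
      have := Finset.card_le_card hst
      rw [h t ht, hcard] at this
      omega

theorem isRLPartition_cliqueCopies (G : SimpleGraph V) (ℓ : ℕ) :
    IsRLPartition (cliqueCopies G ℓ) 0 ℓ (fun v => Sum.inr v.1) :=
  ⟨fun i => i.elim0, fun _ _ hp _ hq hne =>
    ⟨hne, Or.inl (Sum.inr_injective (Eq.trans hp hq.symm))⟩⟩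

theorem isWellCovered_cliqueCopies_iff [Finite V] {k : ℕ}
    (h : ∃ s : Finset V, Maximal G.IsIndepSet (s : Set V) ∧ s.card = k) :
    IsWellCovered (cliqueCopies G (k + 1)) ↔ IsKWellCovered G k := by
  rw [← isKWellCovered_cliqueCopies_iff]
  obtain ⟨t, ht, hc⟩ := h
  obtain ⟨s, hs, hsm⟩ := exists_maximal_cliqueCopies ht (hc.le.trans k.le_succ)
  exact isWellCovered_iff_of_exists ⟨s, hsm, hs.trans hc⟩

end CliqueCopies

/-! ### Joins with edgeless graphs -/

/-- The join of the edgeless graph on `W` with `G`. -/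
def edgelessJoin (W : Type*) (G : SimpleGraph V) : SimpleGraph (W ⊕ V) where
  Adj
    | .inl _, .inl _ => False
    | .inr a, .inr b => G.Adj a b
    | _, _ => True
  symm := ⟨by rintro (a | a) (b | b) h <;> first | trivial | exact SimpleGraph.Adj.symm h⟩
  loopless := ⟨by rintro (a | a) h <;> first | trivial | exact G.loopless.irrefl _ h⟩

theorem maximal_edgelessJoin_inl [Fintype W] [Nonempty W] (G : SimpleGraph V) :
    Maximal (edgelessJoin W G).IsIndepSet
      ((Finset.univ.map Function.Embedding.inl : Finset (W ⊕ V)) : Set (W ⊕ V)) := by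
  refine maximal_isIndepSet_iff.2 ⟨?_, ?_⟩
  · rintro _ ha _ hb -
    obtain ⟨a, -, rfl⟩ := Finset.mem_map.1 ha
    obtain ⟨b, -, rfl⟩ := Finset.mem_map.1 hb
    exact id
  · rintro (a | a) ha
    · simp at ha
    · exact ⟨.inl (Classical.arbitrary W), by simp, trivial⟩

/-- An independent set of the join lies on one side. So the maximal ones are `W` itself, which has
the right size, and those of `G`; the latter are non-empty and therefore dominate `W`. -/
theorem isKWellCovered_edgelessJoin_iff [Fintype W] [Nonempty W] [Nonempty V] [Finite V]
    (G : SimpleGraph V) :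
    IsKWellCovered (edgelessJoin W G) (Fintype.card W) ↔ IsKWellCovered G (Fintype.card W) := by
  constructor
  · intro h s hs
    rw [← h (s.map Function.Embedding.inr), Finset.card_map]
    rw [maximal_isIndepSet_iff] at hs ⊢
    refine ⟨?_, ?_⟩
    · rintro _ ha _ hb hab
      obtain ⟨a, ha', rfl⟩ := Finset.mem_map.1 ha
      obtain ⟨b, hb', rfl⟩ := Finset.mem_map.1 hb
      exact hs.1 ha' hb' fun h => hab (by rw [h])
    · have hne : ∃ v, v ∈ s := by
        by_contra! h
        obtain ⟨u, hu, -⟩ := hs.2 (Classical.arbitrary V) (h _)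
        exact h u hu
      rintro (a | a) ha
      · obtain ⟨v, hv⟩ := hne
        exact ⟨.inr v, by simpa using hv, trivial⟩
      · obtain ⟨u, hu, hua⟩ := hs.2 a (by simpa using ha)
        exact ⟨.inr u, by simpa using hu, hua⟩
  · intro h s hs
    by_cases hl : ∃ a, Sum.inl a ∈ s
    · obtain ⟨a, ha⟩ := hl
      have hsub : (s : Set (W ⊕ V)) ⊆
          (Finset.univ.map Function.Embedding.inl : Finset (W ⊕ V)) := by
        rintro (b | b) hb
        · simp
        · exact (hs.1 ha hb (by simp) trivial).elim
      have := hs.eq_of_subset (maximal_edgelessJoin_inl G).1 hsub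
      rw [Finset.coe_inj.1 this, Finset.card_map, Finset.card_univ]
    · push Not at hl
      have hs' : s = s.toRight.map Function.Embedding.inr := by
        ext (a | a)
        · simpa using hl a
        · simp
      rw [hs', Finset.card_map]
      refine h _ ?_
      rw [maximal_isIndepSet_iff] at hs ⊢
      refine ⟨fun a ha b hb hab => ?_, fun v hv => ?_⟩
      · exact hs.1 (Finset.mem_toRight.1 ha) (Finset.mem_toRight.1 hb) (by simpa using hab)
      · obtain ⟨u | u, hu, huv⟩ := hs.2 (.inr v) fun h => hv (Finset.mem_toRight.2 h)
        · exact (hl u hu).elim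
        · exact ⟨u, Finset.mem_toRight.2 hu, huv⟩

end WellCovered

/-! ### Words of graphs -/

section Words

open Classical in
/-- Adjacency of two vertices given by their numbers. -/
noncomputable def adjBit {n : ℕ} (G : SimpleGraph (Fin n)) (i j : ℕ) : Bool :=
  decide (∃ (hi : i < n) (hj : j < n), G.Adj ⟨i, hi⟩ ⟨j, hj⟩)

/-- A row of the lower triangular adjacency matrix. -/
noncomputable def bitRow {n : ℕ} (G : SimpleGraph (Fin n)) (i : ℕ) : List Bool :=
  (List.range i).map (adjBit G i)

theorem adjBit_eq_true_iff {n : ℕ} {G : SimpleGraph (Fin n)} (i j : Fin n) :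
    adjBit G i j = true ↔ G.Adj i j := by
  simp [adjBit]

theorem length_bitRow {n : ℕ} (G : SimpleGraph (Fin n)) (i : ℕ) : (bitRow G i).length = i := by
  simp [bitRow]

theorem encodeRow_eq {n : ℕ} (G : SimpleGraph (Fin n)) (i : Fin n) :
    encodeRow G i = (bitRow G i).map .bit := by
  refine List.ext_getElem (by simp [encodeRow, bitRow]) fun j h₁ h₂ => ?_
  have hj : j < i := by simpa [encodeRow] using h₁
  simp [encodeRow, bitRow, adjBit, hj.trans i.isLt]

theorem flatMap_finRange {α : Type*} {n : ℕ} (f : ℕ → List α) :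
    ((List.finRange n).flatMap fun i : Fin n => f i.val) = (List.range n).flatMap f := by
  rw [← List.map_coe_finRange_eq_range, List.flatMap_map]

/-- The word with given rows. -/
def unparseRows (rs : List (List Bool)) : List GraphSymbol :=
  rs.flatMap fun r => .vertex :: r.map .bit

theorem unparseRows_append (rs rs' : List (List Bool)) :
    unparseRows (rs ++ rs') = unparseRows rs ++ unparseRows rs' := List.flatMap_append

theorem encodeGraph_eq {n : ℕ} (G : SimpleGraph (Fin n)) :
    encodeGraph G = unparseRows ((List.range n).map (bitRow G)) := by
  rw [unparseRows, List.flatMap_map, ← flatMap_finRange, encodeGraph]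
  simp only [encodeRow_eq]

theorem parseRows_map_bit_append (bs : List Bool) (x : List GraphSymbol) :
    parseRows (bs.map .bit ++ x) = (bs ++ (parseRows x).1, (parseRows x).2) := by
  induction bs with
  | nil => rfl
  | cons b bs ih => simp [parseRows, ih]

theorem parseRows_unparseRows (rs : List (List Bool)) : parseRows (unparseRows rs) = ([], rs) := by
  induction rs with
  | nil => rfl
  | cons r rs ih =>
    rw [unparseRows] at ih
    simp [unparseRows, parseRows, parseRows_map_bit_append, ih]

/-- Parsing loses nothing, even on words that encode no graph. -/
theorem eq_append_unparseRows (x : List GraphSymbol) :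
    x = (parseRows x).1.map .bit ++ unparseRows (parseRows x).2 := by
  fun_induction parseRows x with
  | case1 => rfl
  | case2 b x ih => simpa using ih
  | case3 x ih => simpa [unparseRows] using ih

theorem parseRows_encodeGraph {n : ℕ} (G : SimpleGraph (Fin n)) :
    parseRows (encodeGraph G) = ([], (List.range n).map (bitRow G)) := by
  rw [encodeGraph_eq, parseRows_unparseRows]

theorem eq_of_bitRow_eq {n : ℕ} {G H : SimpleGraph (Fin n)}
    (h : (List.range n).map (bitRow G) = (List.range n).map (bitRow H)) : G = H := by
  have key : ∀ i j : Fin n, j < i → (G.Adj i j ↔ H.Adj i j) := by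
    intro i j hij
    have h₁ := List.map_inj_left.1 h i (List.mem_range.2 i.isLt)
    have h₂ := List.map_inj_left.1 h₁ j (List.mem_range.2 hij)
    rw [← adjBit_eq_true_iff, ← adjBit_eq_true_iff, h₂]
  ext i j
  rcases lt_trichotomy i j with hij | rfl | hij
  · rw [G.adj_comm, H.adj_comm, key j i hij]
  · simp
  · exact key i j hij

/-- A graph is determined by its word. -/
theorem encodeGraph_injective {m n : ℕ} {G : SimpleGraph (Fin m)} {H : SimpleGraph (Fin n)}
    (h : encodeGraph G = encodeGraph H) : ∃ hmn : m = n, hmn ▸ G = H := by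
  have h' := congrArg (fun x => (parseRows x).2) h
  simp only [parseRows_encodeGraph] at h'
  obtain rfl : m = n := by simpa using congrArg List.length h'
  exact ⟨rfl, eq_of_bitRow_eq h'⟩

theorem encodeGraph_eq_nil_iff {n : ℕ} (G : SimpleGraph (Fin n)) :
    encodeGraph G = [] ↔ n = 0 := by
  constructor
  · intro h
    have := parseRows_encodeGraph G
    rw [h] at this
    simpa [parseRows] using (congrArg Prod.snd this).symm
  · rintro rfl
    rfl

/-- Words in which the `i`-th row has length `i` are words of graphs. -/
theorem exists_encodeGraph_eq {rs : List (List Bool)}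
    (h : rs.map List.length = List.range rs.length) :
    ∃ G : SimpleGraph (Fin rs.length), encodeGraph G = unparseRows rs := by
  -- The default values never matter: only entries with `j < i` are used, and row `i` has length
  -- `i`.
  let B : ℕ → ℕ → Prop := fun i j => (rs[i]?.getD [])[j]?.getD false = true
  let G : SimpleGraph (Fin rs.length) :=
    { Adj := fun i j => (j < i ∧ B i j) ∨ (i < j ∧ B j i)
      symm := ⟨fun _ _ h => h.symm⟩
      loopless := ⟨fun _ h => by simp at h⟩ }
  refine ⟨G, ?_⟩
  rw [encodeGraph_eq]
  congr 1
  refine List.ext_getElem (by simp) fun i h₁ h₂ => ?_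
  have hi : rs[i].length = i := by
    have := List.getElem_of_eq h (i := i) (by simpa using h₂)
    simpa using this
  rw [List.getElem_map, List.getElem_range]
  refine List.ext_getElem (by rw [length_bitRow, hi]) fun j h₃ h₄ => ?_
  have hj : j < i := by rwa [hi] at h₄
  simp only [bitRow, List.getElem_map, List.getElem_range]
  rw [Bool.eq_iff_iff,
    adjBit_eq_true_iff (⟨i, h₂⟩ : Fin rs.length) ⟨j, hj.trans h₂⟩]
  simp [G, B, hj, hj.not_gt, h₂, h₄]

/-- Forget the partition. -/
def PartSymbol.graphSymbol? : PartSymbol → Option GraphSymbol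
  | .sym s => some s
  | _ => none

theorem filterMap_replicate_clique (n : ℕ) :
    (List.replicate n PartSymbol.clique).filterMap PartSymbol.graphSymbol? = [] := by
  simp [PartSymbol.graphSymbol?]

theorem filterMap_map_sym (l : List GraphSymbol) :
    (l.map PartSymbol.sym).filterMap PartSymbol.graphSymbol? = l := by
  induction l with
  | nil => rfl
  | cons a l ih => simpa [PartSymbol.graphSymbol?] using ih

theorem filterMap_encodeRLGraph {n r ℓ : ℕ} (G : SimpleGraph (Fin n))
    (p : Fin n → Fin r ⊕ Fin ℓ) :
    (encodeRLGraph G p).filterMap PartSymbol.graphSymbol? = encodeGraph G := by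
  rw [encodeRLGraph, List.filterMap_flatMap, encodeGraph]
  congr 1
  funext i
  have : (encodePart (p i)).filterMap PartSymbol.graphSymbol? = [] := by
    rcases p i with j | j <;> simp [encodePart, PartSymbol.graphSymbol?]
  rw [List.filterMap_cons_some (f := PartSymbol.graphSymbol?) (b := .vertex) rfl, List.filterMap_append, this, filterMap_map_sym,
    List.nil_append]

/-- A row with the number of a clique. -/
def cliqueRow (c : ℕ) (bs : List Bool) : List PartSymbol :=
  .vertex :: (List.replicate (c + 1) .clique ++ bs.map .bit)

theorem filterMap_cliqueRow (c : ℕ) (bs : List Bool) :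
    (cliqueRow c bs).filterMap PartSymbol.graphSymbol? = .vertex :: bs.map .bit := by
  rw [cliqueRow, List.filterMap_cons_some (f := PartSymbol.graphSymbol?) (b := .vertex) rfl, List.filterMap_append,
    filterMap_replicate_clique, List.nil_append]
  have := filterMap_map_sym (bs.map .bit)
  rw [List.map_map] at this
  exact congrArg _ this

theorem encodeRLGraph_eq {n ℓ : ℕ} (G : SimpleGraph (Fin n)) (p : Fin n → Fin ℓ) (c : ℕ → ℕ)
    (hc : ∀ i, (p i : ℕ) = c i) :
    encodeRLGraph (r := 0) G (fun i => Sum.inr (p i)) =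
      (List.range n).flatMap fun i => cliqueRow (c i) (bitRow G i) := by
  rw [← flatMap_finRange, encodeRLGraph]
  refine List.flatMap_congr fun i _ => ?_
  rw [encodePart, hc, encodeRow_eq, List.map_map]
  rfl

end Words

/-! ### The word computed by the reduction -/

section Reduction

/-- The adjacency bits of the `i`-th copy of a vertex with adjacency bits `bs`. -/
def copyBits (k i : ℕ) (bs : List Bool) : List Bool :=
  List.replicate k true ++ ((bs.flatMap fun b => List.replicate i b ++
    true :: List.replicate (k - i) b) ++ List.replicate i true)

theorem length_copyBits {k i : ℕ} (hi : i ≤ k) (bs : List Bool) :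
    (copyBits k i bs).length = k + (bs.length * (k + 1) + i) := by
  have : i + (k - i + 1) = k + 1 := by omega
  simp [copyBits, List.length_flatMap, this]

theorem copyRow_eq {k i : ℕ} (hi : i ≤ k) (bs : List Bool) :
    copyRow i (k - i) bs = cliqueRow i (copyBits k i bs) := by
  simp [copyRow, cliqueRow, copyBits, List.map_flatMap, Nat.add_sub_cancel' hi]
  rfl

theorem freshRow_eq (i : ℕ) : freshRow i = cliqueRow i (List.replicate i false) := by
  simp [freshRow, cliqueRow]

/-- The rows of the graph computed from the rows `rs`. -/
def reductionRows (k : ℕ) (rs : List (List Bool)) : List (List Bool) :=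
  (List.range k).map (List.replicate · false) ++
    rs.flatMap fun bs => (List.range (k + 1)).map fun i => copyBits k i bs

theorem flatMap_copyRows (k : ℕ) (rs : List (List Bool)) :
    rs.flatMap (copyRows k) =
      rs.flatMap fun bs => (List.range (k + 1)).flatMap fun i => cliqueRow i (copyBits k i bs) := by
  congr 1
  funext bs
  refine List.flatMap_congr fun i hi => copyRow_eq ?_ bs
  exact Nat.lt_succ_iff.1 (List.mem_range.1 hi)

theorem filterMap_reductionWord (x : List GraphSymbol) (k : ℕ) :
    (reductionWord x k).filterMap PartSymbol.graphSymbol? =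
      (parseRows x).1.reverse.map .bit ++ unparseRows (reductionRows k (parseRows x).2) := by
  rw [reductionWord, List.filterMap_append, List.filterMap_append, reductionRows,
    unparseRows_append, flatMap_copyRows]
  congr 1
  · have := filterMap_map_sym ((parseRows x).1.reverse.map .bit)
    rwa [List.map_map] at this
  · simp only [unparseRows, List.filterMap_flatMap, freshRow_eq, filterMap_cliqueRow,
      List.flatMap_map, List.flatMap_assoc]

/-- The list collects the row lengths of the output when the input rows have lengths `L`. The first
entry of the last block is `k + l * (k + 1)` and stands at position `k + L.length * (k + 1)`, so `l
= L.length`; the rest is induction. -/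
theorem eq_range_of_flatMap_eq_range {k m : ℕ} {L : List ℕ}
    (h : (List.range k ++ L.flatMap fun l => (List.range (k + 1)).map fun i =>
      k + (l * (k + 1) + i)) = List.range m) : L = List.range L.length := by
  induction L using List.reverseRecOn generalizing m with
  | nil => rfl
  | append_singleton L l ih =>
    have hm : m = k + L.length * (k + 1) + (k + 1) := by
      have := congrArg List.length h
      simp [List.length_flatMap] at this
      rw [← this]
      ring
    rw [List.flatMap_append, List.flatMap_singleton, ← List.append_assoc, hm,
      List.range_add (n := k + L.length * (k + 1))] at h
    obtain ⟨h₁, h₂⟩ := List.append_inj h (by simp [List.length_flatMap])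
    have h₃ := List.map_inj_left.1 h₂ 0 (by simp)
    have h₄ : l = L.length := by
      refine Nat.eq_of_mul_eq_mul_right k.succ_pos ?_
      simp only [Nat.succ_eq_add_one]
      omega
    rw [List.length_append, List.length_singleton, List.range_succ, ← ih h₁, h₄]

/-- If the computed word is the word of a graph, then so is the given word. -/
theorem exists_encodeGraph_of_reductionWord {x : List GraphSymbol} {k m : ℕ}
    {H : SimpleGraph (Fin m)} {r ℓ : ℕ} {p : Fin m → Fin r ⊕ Fin ℓ}
    (h : reductionWord x k = encodeRLGraph H p) :
    ∃ (n : ℕ) (G : SimpleGraph (Fin n)), x = encodeGraph G := by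
  have h₁ := congrArg (fun w => parseRows (w.filterMap PartSymbol.graphSymbol?)) h
  -- Without the partition symbols, both words are parsed: a graph word has no leading bits, hence
  -- neither has `x`, and the rows agree.
  simp only [filterMap_reductionWord, filterMap_encodeRLGraph, parseRows_encodeGraph,
    parseRows_map_bit_append, parseRows_unparseRows, Prod.mk.injEq, List.append_nil,
    List.reverse_eq_nil_iff] at h₁
  obtain ⟨h₁, h₂⟩ := h₁
  have h₃ : ((parseRows x).2.map List.length).length = (parseRows x).2.length := by simp
  have h₄ : (parseRows x).2.map List.length = List.range (parseRows x).2.length := by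
    rw [← h₃]
    refine eq_range_of_flatMap_eq_range (k := k) (m := m) ?_
    have := congrArg (List.map List.length) h₂
    have hm : (List.range m).map (fun i => (bitRow H i).length) = List.range m := by
      simp [length_bitRow]
    rw [List.map_map, Function.comp_def, hm, reductionRows, List.map_append, List.map_map,
      List.map_flatMap] at this
    rw [← this, List.flatMap_map]
    congr 1
    · simp [Function.comp_def]
    · refine List.flatMap_congr fun bs _ => ?_
      rw [List.map_map]
      refine List.map_congr_left fun i hi => ?_
      exact (length_copyBits (Nat.lt_succ_iff.1 (List.mem_range.1 hi)) bs).symm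
  obtain ⟨G, hG⟩ := exists_encodeGraph_eq h₄
  refine ⟨_, G, ?_⟩
  rw [hG, eq_append_unparseRows x, h₁]
  simp [parseRows_unparseRows]

end Reduction

/-! ### The graph computed by the reduction -/

section ReductionGraph

variable {n : ℕ}

/-- The vertices are numbered such that the additional independent vertices come first, followed
by the copies of the first vertex, the copies of the second vertex, and so on. -/
def vertexEquiv (n k : ℕ) : Fin k ⊕ (Fin (k + 1) × Fin n) ≃ Fin (k + n * (k + 1)) :=
  ((Equiv.refl _).sumCongr ((Equiv.prodComm _ _).trans finProdFinEquiv)).trans finSumFinEquiv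

theorem vertexEquiv_inl (k : ℕ) (a : Fin k) : (vertexEquiv n k (.inl a) : ℕ) = a := rfl

theorem vertexEquiv_inr (k : ℕ) (i : Fin (k + 1)) (v : Fin n) :
    (vertexEquiv n k (.inr (i, v)) : ℕ) = k + (v * (k + 1) + i) := by
  change k + ((i : ℕ) + (k + 1) * v) = _
  ring

/-- The graph computed by the reduction. -/
def reductionGraph (G : SimpleGraph (Fin n)) (k : ℕ) : SimpleGraph (Fin (k + n * (k + 1))) :=
  (edgelessJoin (Fin k) (cliqueCopies G (k + 1))).comap (vertexEquiv n k).symm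

/-- The clique containing a vertex. -/
def reductionClique (n k : ℕ) (a : Fin (k + n * (k + 1))) : Fin (k + 1) :=
  ((vertexEquiv n k).symm a).elim Fin.castSucc Prod.fst

variable (G : SimpleGraph (Fin n)) (k : ℕ)

theorem reductionGraph_adj (x y : Fin k ⊕ (Fin (k + 1) × Fin n)) :
    (reductionGraph G k).Adj (vertexEquiv n k x) (vertexEquiv n k y) ↔
      (edgelessJoin (Fin k) (cliqueCopies G (k + 1))).Adj x y := by
  simp [reductionGraph]

/-- `Fin.castSucc` puts the fresh vertices in different cliques, and each of them is adjacent to all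
copies. -/
theorem isRLPartition_reductionGraph :
    IsRLPartition (reductionGraph G k) 0 (k + 1) (fun a => Sum.inr (reductionClique n k a)) := by
  refine ⟨fun i => i.elim0, fun j a ha b hb hab => ?_⟩
  have h : reductionClique n k a = reductionClique n k b :=
    Sum.inr_injective (Eq.trans ha hb.symm)
  obtain ⟨x, rfl⟩ := (vertexEquiv n k).surjective a
  obtain ⟨y, rfl⟩ := (vertexEquiv n k).surjective b
  rw [reductionGraph_adj]
  simp only [reductionClique, Equiv.symm_apply_apply] at h
  have hxy : x ≠ y := fun h => hab (by rw [h])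
  rcases x with x | x <;> rcases y with y | y
  · exact hxy (congrArg _ (Fin.castSucc_injective k h))
  · trivial
  · trivial
  · exact ⟨fun h => hxy (congrArg _ h), Or.inl h⟩

variable {k} in
-- The fresh vertices form a maximal independent set of size `k`, so being well-covered means that
-- all sizes are `k`; this property survives removing the join and then the copies.
theorem isWellCovered_reductionGraph_iff (hn : 0 < n) (hk : 1 ≤ k) :
    IsWellCovered (reductionGraph G k) ↔ IsKWellCovered G k := by
  have : Nonempty (Fin k) := ⟨⟨0, hk⟩⟩
  have : Nonempty (Fin n) := ⟨⟨0, hn⟩⟩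
  have he := reductionGraph_adj G k
  have h := maximal_isIndepSet_map (vertexEquiv n k) he (maximal_edgelessJoin_inl _)
  rw [isWellCovered_iff_of_exists (k := k) ⟨_, h, by simp⟩,
    ← isKWellCovered_cliqueCopies_iff (G := G)]
  have hj := isKWellCovered_edgelessJoin_iff (W := Fin k) (cliqueCopies G (k + 1))
  rw [Fintype.card_fin] at hj
  rw [← hj]
  exact ⟨isKWellCovered_of_equiv _ he,
    isKWellCovered_of_equiv (vertexEquiv n k).symm fun a b => Iff.rfl⟩

theorem adjBit_reductionGraph (x y : Fin k ⊕ (Fin (k + 1) × Fin n)) {a b : ℕ}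
    (ha : (vertexEquiv n k x : ℕ) = a) (hb : (vertexEquiv n k y : ℕ) = b) :
    adjBit (reductionGraph G k) a b = true ↔
      (edgelessJoin (Fin k) (cliqueCopies G (k + 1))).Adj x y := by
  rw [← ha, ← hb, adjBit_eq_true_iff, reductionGraph_adj]

theorem bitRow_reductionGraph_fresh {a : ℕ} (ha : a < k) :
    bitRow (reductionGraph G k) a = List.replicate a false := by
  refine List.eq_replicate_iff.2 ⟨length_bitRow _ _, fun c hc => ?_⟩
  obtain ⟨b, hb, rfl⟩ := List.mem_map.1 hc
  have hb : b < a := List.mem_range.1 hb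
  rw [Bool.eq_false_iff]
  intro h
  exact (adjBit_reductionGraph G k (.inl ⟨a, ha⟩) (.inl ⟨b, hb.trans ha⟩) rfl rfl).1 h

theorem range_mul (n m : ℕ) :
    List.range (n * m) = (List.range n).flatMap fun v => (List.range m).map (v * m + ·) := by
  induction n with
  | zero => simp
  | succ n ih =>
    rw [Nat.succ_mul, List.range_add, ih, List.range_succ, List.flatMap_append,
      List.flatMap_singleton]

theorem map_range_eq_copyBlock {i : ℕ} (hi : i ≤ k) (b : Bool) (f : ℕ → Bool) (h₁ : f i = true)
    (h₂ : ∀ j ≤ k, j ≠ i → f j = b) : (List.range (k + 1)).map f =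
      List.replicate i b ++ true :: List.replicate (k - i) b := by
  obtain ⟨l, rfl⟩ := Nat.exists_eq_add_of_le hi
  have h : (List.range (i + l + 1)).map f =
      (List.range i).map f ++ f i :: (List.range l).map fun j => f (i + (j + 1)) := by
    rw [Nat.add_assoc, List.range_add, List.map_append, List.map_map, List.range_succ_eq_map,
      List.map_cons, List.map_map]
    rfl
  rw [h, h₁, Nat.add_sub_cancel_left]
  congr 1
  · refine List.eq_replicate_iff.2 ⟨by simp, fun c hc => ?_⟩
    obtain ⟨j, hj, rfl⟩ := List.mem_map.1 hc
    have := List.mem_range.1 hj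
    exact h₂ j (by omega) (by omega)
  · congr 1
    refine List.eq_replicate_iff.2 ⟨by simp, fun c hc => ?_⟩
    obtain ⟨j, hj, rfl⟩ := List.mem_map.1 hc
    have := List.mem_range.1 hj
    exact h₂ _ (by omega) (by omega)

/-- The vertices numbered before copy `i` of `v` are the fresh ones, the full blocks of copies of
each `u < v`, and the first `i` copies of `v`. These are the three pieces of `copyBits`. -/
theorem bitRow_reductionGraph_copy {v i : ℕ} (hv : v < n) (hi : i ≤ k) :
    bitRow (reductionGraph G k) (k + (v * (k + 1) + i)) = copyBits k i (bitRow G v) := by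
  have hi' : i < k + 1 := Nat.lt_succ_of_le hi
  have hx := vertexEquiv_inr k ⟨i, hi'⟩ ⟨v, hv⟩
  rw [bitRow, List.range_add, List.range_add, range_mul, copyBits, List.map_append, List.map_map,
    List.map_append, List.map_flatMap, List.map_map]
  congr 1
  · refine List.eq_replicate_iff.2 ⟨by simp, fun c hc => ?_⟩
    obtain ⟨b, hb, rfl⟩ := List.mem_map.1 hc
    exact (adjBit_reductionGraph G k _ (.inl ⟨b, List.mem_range.1 hb⟩) hx rfl).2 trivial
  congr 1
  · rw [bitRow, List.flatMap_map]
    refine List.flatMap_congr fun u hu => ?_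
    have hu : u < v := List.mem_range.1 hu
    rw [List.map_map]
    refine map_range_eq_copyBlock k hi _ _ ?_ fun j hj hji => ?_
    · refine (adjBit_reductionGraph G k _ (.inr (⟨i, hi'⟩, ⟨u, hu.trans hv⟩)) hx
        (vertexEquiv_inr ..)).2 ⟨?_, Or.inl rfl⟩
      simpa using hu.ne'
    · rw [Bool.eq_iff_iff]
      refine (adjBit_reductionGraph G k _ (.inr (⟨j, Nat.lt_succ_of_le hj⟩, ⟨u, hu.trans hv⟩)) hx
        (vertexEquiv_inr ..)).trans ?_
      rw [adjBit_eq_true_iff (⟨v, hv⟩ : Fin n) ⟨u, hu.trans hv⟩]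
      change _ ∧ _ ↔ _
      simp [hji.symm, hu.ne']
  · refine List.eq_replicate_iff.2 ⟨by simp, fun c hc => ?_⟩
    obtain ⟨j, hj, rfl⟩ := List.mem_map.1 hc
    have hj : j < i := List.mem_range.1 hj
    refine (adjBit_reductionGraph G k _ (.inr (⟨j, hj.trans hi'⟩, ⟨v, hv⟩)) hx
      (vertexEquiv_inr ..)).2 ⟨?_, Or.inr (Or.inl rfl)⟩
    simpa using hj.ne'

theorem reductionWord_encodeGraph :
    reductionWord (encodeGraph G) k =
      encodeRLGraph (r := 0) (reductionGraph G k) (fun a => Sum.inr (reductionClique n k a)) := by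
  -- Copies are numbered vertex by vertex, so the clique of a copy is a remainder modulo `k + 1`.
  have hc : ∀ a : Fin (k + n * (k + 1)), (reductionClique n k a : ℕ) =
      if (a : ℕ) < k then (a : ℕ) else (a - k) % (k + 1) := by
    intro a
    obtain ⟨x, rfl⟩ := (vertexEquiv n k).surjective a
    rw [reductionClique, Equiv.symm_apply_apply]
    rcases x with x | ⟨i, v⟩
    · rw [vertexEquiv_inl, if_pos x.isLt]
      rfl
    · rw [vertexEquiv_inr, if_neg (by omega), Nat.add_sub_cancel_left, Nat.mul_add_mod_of_lt i.isLt]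
      rfl
  rw [encodeRLGraph_eq _ _ (fun a => if a < k then a else (a - k) % (k + 1)) hc, reductionWord,
    parseRows_encodeGraph, List.range_add, range_mul, List.flatMap_append, flatMap_copyRows]
  simp only [List.reverse_nil, List.map_nil, List.nil_append, List.flatMap_map, List.map_flatMap,
    List.flatMap_assoc]
  congr 1
  · refine List.flatMap_congr fun a ha => ?_
    have ha : a < k := List.mem_range.1 ha
    rw [freshRow_eq, if_pos ha, bitRow_reductionGraph_fresh G k ha]
  · refine List.flatMap_congr fun v hv => List.flatMap_congr fun i hi => ?_
    have hv : v < n := List.mem_range.1 hv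
    have hi : i < k + 1 := List.mem_range.1 hi
    rw [bitRow_reductionGraph_copy G k hv (Nat.lt_succ_iff.1 hi), if_neg (by omega),
      Nat.add_sub_cancel_left, Nat.mul_add_mod_of_lt hi]

end ReductionGraph

theorem reduction_encodeGraph {n k : ℕ} (G : SimpleGraph (Fin n)) (hn : 0 < n) (hk : 1 ≤ k) :
    reduction (encodeGraph G, k) = (encodeRLGraph (r := 0) (reductionGraph G k)
      (fun a => Sum.inr (reductionClique n k a)), k + 1) := by
  have hx : encodeGraph G ≠ [] := fun h => hn.ne' ((encodeGraph_eq_nil_iff G).1 h)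
  have hk' : k ≠ 0 := by omega
  rw [reduction, if_neg (by simp [hx, hk']), reductionWord_encodeGraph]

theorem reduction_correct (I : List GraphSymbol × ℕ) :
    I ∈ kWellCoveredGraph ↔ reduction I ∈ wcRLGraph 0 := by
  obtain ⟨x, k⟩ := I
  constructor
  · rintro ⟨n, G, hn, hx, hG⟩
    dsimp only at hx hG
    subst hx
    have : Nonempty (Fin n) := ⟨⟨0, hn⟩⟩
    have hk : 1 ≤ k := by
      by_contra! h
      obtain rfl : k = 0 := by omega
      exact not_isKWellCovered_zero G hG
    rw [reduction_encodeGraph G hn hk]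
    exact ⟨_, reductionGraph G k, _, by omega, isRLPartition_reductionGraph G k, rfl,
      (isWellCovered_reductionGraph_iff G hn hk).2 hG⟩
  · rintro ⟨m, H, p, hm, -, hw, hH⟩
    -- The empty word encodes only the graph without vertices, so `([], 0)` is a no-instance.
    by_cases h : k = 0 ∨ x = []
    · replace hw := (congrArg Prod.fst (if_pos h : reduction (x, k) = ([], 0))).symm.trans hw
      have hnil := filterMap_encodeRLGraph H p
      rw [← hw] at hnil
      exact absurd ((encodeGraph_eq_nil_iff H).1 hnil.symm) hm.ne'
    · replace hw := (congrArg Prod.fst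
        (if_neg h : reduction (x, k) = (reductionWord x k, k + 1))).symm.trans hw
      push Not at h
      obtain ⟨n, G, rfl⟩ := exists_encodeGraph_of_reductionWord hw
      have hn : 0 < n := Nat.pos_of_ne_zero fun h0 => h.2 ((encodeGraph_eq_nil_iff G).2 h0)
      have hk : 1 ≤ k := Nat.one_le_iff_ne_zero.2 h.1
      refine ⟨n, G, hn, rfl, (isWellCovered_reductionGraph_iff G hn hk).1 ?_⟩
      -- Forgetting the partitions identifies `H` with `reductionGraph G k`; the partition `p` plays
      -- no role in being well-covered.
      have he := congrArg (List.filterMap PartSymbol.graphSymbol?) hw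
      rw [reductionWord_encodeGraph, filterMap_encodeRLGraph, filterMap_encodeRLGraph] at he
      obtain ⟨rfl, rfl⟩ := encodeGraph_injective he
      exact hH

theorem isFptReduction_reduction : IsFptReduction kWellCoveredGraph (wcRLGraph 0) reduction where
  correct := reduction_correct
  computable := isFptComputable_reduction
  param_bound := ⟨fun k => k + 1, Primrec.succ.to_comp, fun I => by
    unfold reduction
    split_ifs
    · exact Nat.zero_le _
    · exact le_rfl⟩

theorem mainTheorem8 :
    (∃ R : List GraphSymbol × ℕ → List PartSymbol × ℕ,
      IsFptReduction kWellCoveredGraph (wcRLGraph 0) R ∧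
      ∀ (n : ℕ) (G : SimpleGraph (Fin n)) (k : ℕ), 0 < n → 1 ≤ k →
        ∃ (m : ℕ) (H : SimpleGraph (Fin m)) (p : Fin m → Fin 0 ⊕ Fin (k + 1)), 0 < m ∧
          IsRLPartition H 0 (k + 1) p ∧ R (encodeGraph G, k) = (encodeRLGraph H p, k + 1)) ∧
    (∀ (V : Type*) [Finite V] [Nonempty V] (G : SimpleGraph V) (k : ℕ),
      (∃ I : Finset V, Maximal G.IsIndepSet (I : Set V) ∧ I.card = k) →
        IsRLPartition (cliqueCopies G (k + 1)) 0 (k + 1) (fun v => Sum.inr v.1) ∧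
        (IsWellCovered (cliqueCopies G (k + 1)) ↔ IsKWellCovered G k)) := by
  refine ⟨⟨reduction, isFptReduction_reduction, fun n G k hn hk => ?_⟩, fun V _ _ G k h => ?_⟩
  · exact ⟨_, reductionGraph G k, fun a => Sum.inr (reductionClique n k a), by omega,
      isRLPartition_reductionGraph G k, reduction_encodeGraph G hn hk⟩
  · exact ⟨isRLPartition_cliqueCopies G (k + 1), isWellCovered_cliqueCopies_iff h⟩
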